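/- **Setting.** Let $S\subset\mathbb R^p\times\mathbb R^q$ be compact, $f\ge 0$ a density that is continuous on $S$ and vanishes off $S$, and $(X_n,Y_n)_{n\ge 1}$ i.i.d. random vectors with density $f$. Write $D=D_N$ for the first $N$ observations $(x_n,y_n)_{n\le N}$, and $\mathcal L(X)=\prod_{n\le N} f_X(x_n)$ with $f_X(x)=\int f(x,y)\,dy$. *Competing models* $m=1,\dots,M$. Model $m$ has conditional densities $f_m(y|x;\theta)$, $\theta\in\Theta_m\subset\mathbb R^{K_m}$ ($\Theta_m$ measurable), likelihood $\mathcal L_m(\theta;Y|X)=\prod_{n\le N} f_m(y_n|x_n;\theta)$ and a prior density $\pi_m$ on $\Theta_m$. Assume that * $f_m$ is positive and jointly continuous in $(x,y,\theta)$ on $S\times\Theta_m$; * $\Theta_m$ is compact, or $\Theta_m$ is convex and $\theta\mapsto\log f_m(y|x;\theta)$ is concave on it for each $(x,y)\in S$; * $\theta\mapsto \mathbb E\log f_m(Y_1|X_1;\theta)$ has a unique maximizer $\theta_m^0$ on $\Theta_m$, it is interior, on a neighbourhood of it $\log f_m$ is $C^2$ in $\theta$ with second derivative jointly continuous in $(x,y,\theta)$,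 $(x,y)\in S$, and $\mathbb E\,D^2_\theta\log f_m(Y_1|X_1;\theta_m^0)$ is negative definite (the model need not contain the truth). *Benchmark model* $0$. For $Z=(X,Y)$ and for $Z=X$ let $S_Z$ be a compact set containing $S$, respectively the projection of $S$ to $\mathbb R^p$; let $T_Z:S_Z\to\mathbb R^{K_Z}$ be bounded and Lebesgue measurable, no nontrivial linear combination of its components being almost surely constant under the law of $Z$. Let $\mathcal L(\theta;Z)$ be the likelihood of the exponential family $f_Z(z;\theta)=e^{\theta'T_Z(z)}/\int_{S_Z}e^{\theta'T_Z}$, $\theta\in\mathbb R^{K_Z}$, and $\pi_Z$ a prior density on $\mathbb R^{K_Z}$. The *optimum information estimator* $\hat f_Z$ minimizes $\int_{S_Z} g\log g$ among densities $g$ on $S_Z$ with $\int_{S_Z} T_Z\,g=\frac1N\sum_{n\le N}T_Z(z_n)$. Model $0$ is the conditional model that belongs to $\hat f(y|x)=\hat f_{X,Y}(x,y)/\hat f_X(x)$. All prior densities are measurable probability densities, locally bounded and locally bounded away from $0$ on the interior of the parameter set. *Posterior.* The Bayesian conditional likelihoods are $$B_m=\int_{\Theta_m}\mathcal L_m(\theta;Y|X)\,\pi_m(\theta)\,d\theta\quad(m\ge1),\qquad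 B_0=\frac{\int\mathcal L(\theta;X,Y)\,\pi_{X,Y}(\theta)\,d\theta}{\int\mathcal L(\theta;X)\,\pi_X(\theta)\,d\theta}.$$ Give every model $m=0,\dots,M$ the prior weight $\frac1{M+1}$ and the likelihood $B_m\,\mathcal L(X)$, and let $P(m|D)$ be the posterior probability by Bayes's rule. *Conditional evidence.* For maximum likelihood estimates $\hat\theta_m$, $\hat\theta_{X,Y}$, $\hat\theta_X$ put $$E_m=\log\mathcal L_m(\hat\theta_m;Y|X)-\tfrac12K_m\log N\quad(m\ge1),$$ $$E_0=\log\mathcal L(\hat\theta_{X,Y};X,Y)-\log\mathcal L(\hat\theta_X;X)-\tfrac12(K_{X,Y}-K_X)\log N .$$ **Theorem (Goodness of fit and model selection).** There is a constant $C>0$, not depending on $N$ or on the realization, such that almost surely the following hold. 1. For every $N$ and $m$, the common factor $\mathcal L(X)$ cancels: $P(m|D)=B_m/\sum_{k=0}^M B_k$. 2. For all sufficiently large $N$ maximum likelihood estimates exist in all the families, and for every choice of them: $f_{X,Y}(\cdot\,;\hat\theta_{X,Y})$ and $f_X(\cdot\,;\hat\theta_X)$ are optimum information estimators, and for every $m=0,\dots,M$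 $$\bigl|\log B_m-E_m\bigr|\le C,\qquad C^{-1}\,\frac{e^{E_m}}{\sum_{k=0}^M e^{E_k}}\;\le\; P(m|D)\;\le\; C\,\frac{e^{E_m}}{\sum_{k=0}^M e^{E_k}} .$$ 3. For every choice of maximum likelihood estimates for all large $N$, if some model $m_0$ satisfies $E_{m_0}-E_k\to\infty$ as $N\to\infty$ for all $k\ne m_0$, then for every $m$ $$P(m|D)-\frac{e^{E_m}}{\sum_k e^{E_k}}\to0\qquad\text{and}\qquad P(m|D)-\frac{e^{NE_m}}{\sum_k e^{NE_k}}\to0 .$$ -/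

import Mathlib

open MeasureTheory ProbabilityTheory Filter Topology

noncomputable section

namespace OptInfo

/-- Euclidean space of dimension `d`. -/
abbrev RVec (d : ℕ) := EuclideanSpace ℝ (Fin d)

/-! ### Likelihood, maximum likelihood, Bayesian marginal likelihood -/

section Likelihood

variable {α β : Type*}

/-- Likelihood `∏_{n < N} g(z_n; θ)` of the first `N` observations. -/
def likelihood (g : α → β → ℝ) (z : ℕ → α) (N : ℕ) (θ : β) : ℝ :=
  ∏ n ∈ Finset.range N, g (z n) θ

/-- `θ` is a maximum likelihood estimator over the parameter set `Θ`. -/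
def IsMLE (g : α → β → ℝ) (Θ : Set β) (z : ℕ → α) (N : ℕ) (θ : β) : Prop :=
  θ ∈ Θ ∧ IsMaxOn (likelihood g z N) Θ θ

/-- Bayesian (marginal) likelihood: the likelihood integrated against the prior density `π`. -/
def marginalLikelihood [MeasureSpace β] (g : α → β → ℝ) (Θ : Set β) (π : β → ℝ)
    (z : ℕ → α) (N : ℕ) : ℝ :=
  ∫ θ in Θ, likelihood g z N θ * π θ

end Likelihood

/-- `π` is a prior probability density on `Θ ⊆ ℝ^d` which, on the interior of `Θ`, is locally
bounded and locally bounded away from zero. -/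
structure IsPrior {d : ℕ} (Θ : Set (RVec d)) (π : RVec d → ℝ) : Prop where
  measurable : Measurable π
  nonneg : ∀ θ, 0 ≤ π θ
  lintegral_eq_one : ∫⁻ θ in Θ, ENNReal.ofReal (π θ) = 1
  locally_bounded : ∀ θ ∈ interior Θ, ∃ a b : ℝ, 0 < a ∧ ∀ᶠ t in 𝓝 θ, a ≤ π t ∧ π t ≤ b

/-! ### Exponential families and the optimum information estimator -/

/-- The data of an exponential family `f(x; lam) ∝ exp(lam' T(x))` on `S`, with a prior density on
its parameter space `ℝ^dim`. -/
structure ExpFamily (α : Type*) where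
  dim : ℕ
  S : Set α
  T : α → RVec dim
  prior : RVec dim → ℝ

/-- The density `exp(lam' T(x)) / ∫_S exp(lam' T)` on `S`, and `0` outside `S`. -/
def ExpFamily.density {α : Type*} [MeasureSpace α] (F : ExpFamily α) (x : α) (lam : RVec F.dim) :
    ℝ :=
  F.S.indicator
    (fun x => Real.exp (inner ℝ lam (F.T x)) / ∫ u in F.S, Real.exp (inner ℝ lam (F.T u))) x

/-- Conditions on an exponential family relative to the law `μ` of one observation: `S` is compact,
`T` is Lebesgue measurable and bounded on `S`, no nontrivial linear combination of the components of
`T` is almost surely constant (the set of values of `T` has full affine dimension, null sets being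
disregarded), and the prior is admissible. -/
structure ExpFamily.IsRegular {α : Type*} [MeasureSpace α] [TopologicalSpace α]
    (F : ExpFamily α) (μ : Measure α) : Prop where
  compact : IsCompact F.S
  measurable : AEMeasurable F.T (volume.restrict F.S)
  bounded : ∃ B : ℝ, ∀ x ∈ F.S, ‖F.T x‖ ≤ B
  full_dim : ∀ (lam : RVec F.dim) (c : ℝ), (∀ᵐ x ∂μ, inner ℝ lam (F.T x) = c) → lam = 0
  prior : IsPrior Set.univ F.prior

/-- Sample moment `(1/N) ∑_{n < N} T(z_n)`. -/
def sampleMoment {α : Type*} {d : ℕ} (T : α → RVec d) (z : ℕ → α) (N : ℕ) : RVec d :=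
  (N : ℝ)⁻¹ • ∑ n ∈ Finset.range N, T (z n)

/-- `g` is a probability density on `S` with `∫_S T g = m`. -/
def MomentAdmissible {α : Type*} [MeasureSpace α] {d : ℕ} (S : Set α) (T : α → RVec d)
    (m : RVec d) (g : α → ℝ) : Prop :=
  IntegrableOn g S ∧ (∀ᵐ x ∂(volume.restrict S), 0 ≤ g x) ∧ ∫ x in S, g x = 1 ∧
    IntegrableOn (fun x => g x • T x) S ∧ ∫ x in S, g x • T x = m

/-- `g` minimizes `∫_S g log g` among the densities on `S` with `∫_S T g = m`. On a set of finite
volume `h log h` has an integrable negative part, so if it is not integrable then its integral is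
`+∞`; competitors of infinite information need not be compared. -/
def IsOIE {α : Type*} [MeasureSpace α] {d : ℕ} (S : Set α) (T : α → RVec d)
    (m : RVec d) (g : α → ℝ) : Prop :=
  MomentAdmissible S T m g ∧ IntegrableOn (fun x => g x * Real.log (g x)) S ∧
    ∀ h : α → ℝ, MomentAdmissible S T m h → IntegrableOn (fun x => h x * Real.log (h x)) S →
      ∫ x in S, g x * Real.log (g x) ≤ ∫ x in S, h x * Real.log (h x)

/-! ### Parametric conditional models -/

/-- A parametric model `f(y | x; θ)`, `θ ∈ Θ ⊆ ℝ^dim`, with a prior density on `Θ`.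
`density (x, y) θ` stands for `f(y | x; θ)`. -/
structure CondModel (p q : ℕ) where
  dim : ℕ
  Θ : Set (RVec dim)
  density : RVec p × RVec q → RVec dim → ℝ
  prior : RVec dim → ℝ

/-- Regularity of a conditional model on the support `S` of the data, whose law is `μ`; the model
need not contain the truth. -/
structure CondModel.IsRegular {p q : ℕ} (F : CondModel p q) (S : Set (RVec p × RVec q))
    (μ : Measure (RVec p × RVec q)) : Prop where
  measurableSet : MeasurableSet F.Θ
  prior : IsPrior F.Θ F.prior
  /-- `f(· | x; θ)` is a probability density. -/
  measurable : ∀ x ∈ Prod.fst '' S, ∀ θ ∈ F.Θ, Measurable fun y => F.density (x, y) θ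
  nonneg : ∀ x ∈ Prod.fst '' S, ∀ θ ∈ F.Θ, ∀ y, 0 ≤ F.density (x, y) θ
  lintegral_eq_one : ∀ x ∈ Prod.fst '' S, ∀ θ ∈ F.Θ,
    ∫⁻ y, ENNReal.ofReal (F.density (x, y) θ) = 1
  /-- `f(y | x; θ)` is positive and jointly continuous on the support. -/
  pos : ∀ z ∈ S, ∀ θ ∈ F.Θ, 0 < F.density z θ
  continuousOn : ContinuousOn (fun w : (RVec p × RVec q) × RVec F.dim => F.density w.1 w.2)
    (S ×ˢ F.Θ)
  /-- Either the parameter set is compact, or it is convex with a concave log likelihood. -/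
  compact_or_concave : IsCompact F.Θ ∨
    (Convex ℝ F.Θ ∧ ∀ z ∈ S, ConcaveOn ℝ F.Θ fun θ => Real.log (F.density z θ))
  /-- The expected log likelihood has a unique maximizer `θ₀` (the pseudo-true value), it is
  interior, and around it `log f` is twice continuously differentiable in `θ`, with a negative
  definite expected Hessian at `θ₀`. -/
  pseudo_true : ∃ (θ₀ : RVec F.dim) (U : Set (RVec F.dim)), IsOpen U ∧ θ₀ ∈ U ∧ U ⊆ F.Θ ∧
    (∀ θ ∈ F.Θ, θ ≠ θ₀ →
      ∫ z, Real.log (F.density z θ) ∂μ < ∫ z, Real.log (F.density z θ₀) ∂μ) ∧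
    (∀ z ∈ S, ContDiffOn ℝ 2 (fun θ => Real.log (F.density z θ)) U) ∧
    ContinuousOn (fun w : (RVec p × RVec q) × RVec F.dim =>
      iteratedFDeriv ℝ 2 (fun θ => Real.log (F.density w.1 θ)) w.2) (S ×ˢ U) ∧
    ∀ v : RVec F.dim, v ≠ 0 →
      ∫ z, iteratedFDeriv ℝ 2 (fun θ => Real.log (F.density z θ)) θ₀ ![v, v] ∂μ < 0

/-! ### Bayes' rule and the conditional evidence -/

/-- Bayes' rule for finitely many models with prior weights `w` and likelihoods `ℓ`. -/
def posterior {ι : Type*} [Fintype ι] (w ℓ : ι → ℝ) (m : ι) : ℝ :=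
  w m * ℓ m / ∑ k, w k * ℓ k

/-- `exp(E_m) / ∑_k exp(E_k)`. -/
def expWeights {ι : Type*} [Fintype ι] (E : ι → ℝ) (m : ι) : ℝ :=
  Real.exp (E m) / ∑ k, Real.exp (E k)

/-- The density `∫ f(x, y) dy` of `X`, where `(X, Y)` has the density `f` on `S`. -/
def marginalDensity {p q : ℕ} (S : Set (RVec p × RVec q)) (f : RVec p × RVec q → ℝ)
    (x : RVec p) : ℝ :=
  ∫ y, S.indicator f (x, y)

/-- The models under comparison: `joint` and `marg` are the exponential families behind the optimum
information estimators of `f(x, y)` and of `f(x)`; together they make up model `0`. The conditional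
model of index `m : Fin M` in `comp` is model `m + 1`. -/
structure Models (p q M : ℕ) where
  joint : ExpFamily (RVec p × RVec q)
  marg : ExpFamily (RVec p)
  comp : Fin M → CondModel p q

namespace Models

variable {p q M : ℕ} (𝓜 : Models p q M)

/-- Bayesian likelihood of the `y`-data given the `x`-data under each model. For model `0`, whose
conditional density is the quotient `f(x, y) / f(x)`, it is the quotient of the Bayesian likelihoods
of the two exponential families. -/
def condLikelihood (z : ℕ → RVec p × RVec q) (N : ℕ) : Fin (M + 1) → ℝ :=
  Fin.cons
    (marginalLikelihood 𝓜.joint.density Set.univ 𝓜.joint.prior z N /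
      marginalLikelihood 𝓜.marg.density Set.univ 𝓜.marg.prior (fun n => (z n).1) N)
    (fun m => marginalLikelihood (𝓜.comp m).density (𝓜.comp m).Θ (𝓜.comp m).prior z N)

/-- Posterior model probability `P(m | D)` under uniform prior weights `1 / (M + 1)`. The likelihood
of the whole data under model `m` is its conditional likelihood times the likelihood of the
`x`-data under the density `fX` of `X`. -/
def posteriorProb (fX : RVec p → ℝ) (z : ℕ → RVec p × RVec q) (N : ℕ) : Fin (M + 1) → ℝ :=
  posterior (fun _ => 1 / ((M : ℝ) + 1))
    (fun m => 𝓜.condLikelihood z N m * ∏ n ∈ Finset.range N, fX (z n).1)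

/-- A choice of a parameter value in each family. -/
structure Params where
  joint : RVec 𝓜.joint.dim
  marg : RVec 𝓜.marg.dim
  comp : ∀ m, RVec (𝓜.comp m).dim

variable {𝓜} in
/-- All the parameter values are maximum likelihood estimates from the first `N` observations. -/
structure Params.IsMLE (t : 𝓜.Params) (z : ℕ → RVec p × RVec q) (N : ℕ) : Prop where
  joint : OptInfo.IsMLE 𝓜.joint.density Set.univ z N t.joint
  marg : OptInfo.IsMLE 𝓜.marg.density Set.univ (fun n => (z n).1) N t.marg
  comp : ∀ m, OptInfo.IsMLE (𝓜.comp m).density (𝓜.comp m).Θ z N (t.comp m)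

variable {𝓜} in
/-- Conditional evidence: for model `m ≥ 1` it is `log L_m(θ_m; Y | X) - (K_m / 2) log N`, for
model `0` it is
`log L(θ_{X,Y}; X, Y) - log L(θ_X; X) - ((K_{X,Y} - K_X) / 2) log N`. -/
def Params.evidence (t : 𝓜.Params) (z : ℕ → RVec p × RVec q) (N : ℕ) : Fin (M + 1) → ℝ :=
  Fin.cons
    (Real.log (likelihood 𝓜.joint.density z N t.joint)
      - Real.log (likelihood 𝓜.marg.density (fun n => (z n).1) N t.marg)
      - 1 / 2 * ((𝓜.joint.dim : ℝ) - (𝓜.marg.dim : ℝ)) * Real.log N)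
    (fun m => Real.log (likelihood (𝓜.comp m).density z N (t.comp m))
      - 1 / 2 * ((𝓜.comp m).dim : ℝ) * Real.log N)

end Models

end OptInfo

end

/-!
The evidence `log L(θ̂) - (d / 2) log N` approximates the logarithm of a Bayesian likelihood with
bounded error as soon as the mean log likelihood `ℓ_N` (`meanLogLik`) has two properties: outside a
ball around a fixed point `θ₀` it stays below `ℓ_N(θ₀)` by a fixed gap, and on a larger ball
`ℓ_N(θ̂) - ℓ_N(θ)` lies between two multiples of `‖θ - θ̂‖²` for each of its maximizers `θ̂` near
`θ₀`. For then the likelihood near `θ̂` is pinched between two Gaussians of variance of order `1 / N`,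
whose integrals are of order `N ^ (-d / 2)`, and the rest of the parameter set contributes an
exponentially small term (`laplace_bounds`, `exists_evidenceApprox`). Because only the order of
magnitude is claimed, no convergence of Laplace's approximation is needed, and the constants are
deterministic.

For the conditional models both properties come from the expected log likelihood by a uniform strong
law (`uniform_strong_law`), the strong law in the Banach space of continuous functions on a compact
set of parameters. Applied to `log f` it gives the gap on a compact set, which concavity extends to a
noncompact parameter set (`concave_gap_outside_ball`). Applied to the second derivatives it gives the
quadratic bounds by Taylor's formula (`meanLogLik_quadratic`).

For an exponential family `-ℓ_N(θ)` is the logarithm of `∫ exp(θ' (T - m_N))` with `m_N` the sample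
moment, so that the randomness enters only through `m_N`, and the ordinary strong law suffices. With
the true moment `m` in place of `m_N` this convex function is coercive, hence has a minimizer `θ₀`,
because no nontrivial combination of the components of `T` is almost surely constant
(`exists_min_centeredPartition`). The inequalities `1 + u + u² / 4 ≤ exp u ≤ 1 + u + u²` for
`|u| ≤ 1`, together with the first-order condition, which says that the tilted mean of `T` is `m_N`,
yield the quadratic bounds uniformly for `m_N` near `m` (`exists_centeredPartition_gap`). The same
first-order condition shows that maximum likelihood gives the optimum information estimator, by
Gibbs' inequality (`ExpFamily.IsRegular.isOIE_of_isMin`).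

The bounds on `P(m | D)` follow by exponentiating the bounds on `log B_m` and normalizing
(`expWeights_bounds`). If one evidence exceeds all others by a margin that tends to infinity, then
the posterior and both softmax formulas converge to the same unit mass.
-/

noncomputable section

namespace OptInfo

/-! ### Laplace bounds for marginal likelihoods -/

/-- Exponentially small terms are negligible on the scale `N ^ (-d / 2)`. -/
lemma exp_neg_mul_le_rpow (d : ℕ) {δ : ℝ} (hδ : 0 < δ) {N : ℕ} (hN : 1 ≤ N) :
    Real.exp (-(N * δ)) ≤ (d.factorial / δ ^ d) * (N : ℝ) ^ (-((d : ℝ) / 2)) := by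
  have hN' : (1 : ℝ) ≤ N := by exact_mod_cast hN
  have hN0 : (0 : ℝ) < N := by linarith
  have h1 := Real.pow_div_factorial_le_exp (N * δ) (by positivity) d
  have hf : (0 : ℝ) < d.factorial := by exact_mod_cast d.factorial_pos
  have h2 : (N : ℝ) ^ ((d : ℝ) / 2) ≤ (N : ℝ) ^ d := by
    rw [← Real.rpow_natCast]
    exact Real.rpow_le_rpow_of_exponent_le hN' (by linarith [Nat.cast_nonneg (α := ℝ) d])
  have h3 : 0 < (N : ℝ) ^ ((d : ℝ) / 2) := Real.rpow_pos_of_pos hN0 _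
  rw [Real.exp_neg, Real.rpow_neg hN0.le, ← one_div, ← one_div, div_le_iff₀ (Real.exp_pos _)]
  rw [div_le_iff₀ hf, mul_pow] at h1
  have h4 : (N : ℝ) ^ ((d : ℝ) / 2) * δ ^ d ≤ Real.exp (N * δ) * d.factorial :=
    le_trans (by gcongr) h1
  have : (d.factorial : ℝ) / δ ^ d * (1 / (N : ℝ) ^ ((d : ℝ) / 2)) * Real.exp (N * δ)
      = (Real.exp (N * δ) * d.factorial) / ((N : ℝ) ^ ((d : ℝ) / 2) * δ ^ d) := by
    field_simp
  rw [this, le_div_iff₀ (by positivity), one_mul]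
  exact h4

lemma integral_exp_neg_mul_sq_dist {d : ℕ} {c : ℝ} (hc : 0 < c) {N : ℕ} (hN : 1 ≤ N)
    (t : RVec d) :
    Integrable (fun θ : RVec d => Real.exp (-(N * (c * ‖θ - t‖ ^ 2)))) ∧
    ∫ θ : RVec d, Real.exp (-(N * (c * ‖θ - t‖ ^ 2)))
      = (Real.pi / c) ^ ((d : ℝ) / 2) * (N : ℝ) ^ (-((d : ℝ) / 2)) := by
  have hN0 : (0 : ℝ) < N := by exact_mod_cast hN
  have e : ∀ v : RVec d, Real.exp (-(N * (c * ‖v‖ ^ 2))) = Real.exp (-(N * c) * ‖v‖ ^ 2) := by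
    intro v; congr 1; ring
  have h := GaussianFourier.integral_rexp_neg_mul_sq_norm (V := RVec d) (b := N * c)
    (by positivity)
  have hval : ∫ θ : RVec d, Real.exp (-(N * (c * ‖θ - t‖ ^ 2)))
      = (Real.pi / c) ^ ((d : ℝ) / 2) * (N : ℝ) ^ (-((d : ℝ) / 2)) := by
    rw [integral_sub_right_eq_self (fun v : RVec d => Real.exp (-(N * (c * ‖v‖ ^ 2)))) t]
    simp_rw [e]
    rw [h, finrank_euclideanSpace, Fintype.card_fin, Real.rpow_neg hN0.le,
      ← Real.inv_rpow hN0.le, ← Real.mul_rpow (by positivity) (by positivity)]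
    congr 1
    field_simp
  refine ⟨Integrable.of_integral_ne_zero ?_, hval⟩
  rw [hval]
  have : 0 < Real.pi / c := by positivity
  positivity

lemma rpow_neg_half_pow (d : ℕ) {x : ℝ} (hx : 0 ≤ x) :
    (x ^ (-(1 / 2) : ℝ)) ^ d = x ^ (-((d : ℝ) / 2)) := by
  rw [← Real.rpow_natCast, ← Real.rpow_mul hx]
  congr 1
  ring

/-- An integral of a positive function `L` against a prior, where `L` is pinched between two
Gaussians around `θh` of variance of order `1 / N` and is exponentially small away from it, equals
`L θh * N ^ (-d / 2)` up to a factor that depends only on the constants involved. -/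
theorem laplace_bounds {d : ℕ} {a b c C δ ρ : ℝ} (ha : 0 < a) (hc : 0 < c) (hC : 0 ≤ C)
    (hδ : 0 < δ) (hρ : 0 < ρ) :
    ∃ K : ℝ, ∀ (N : ℕ) (Θ : Set (RVec d)) (π L : RVec d → ℝ) (θ₀ θh : RVec d), 1 ≤ N →
      MeasurableSet Θ → IsPrior Θ π →
      (∀ θ ∈ Metric.closedBall θ₀ (2 * ρ), θ ∈ Θ ∧ a ≤ π θ ∧ π θ ≤ b) →
      ContinuousOn L Θ → (∀ θ ∈ Θ, 0 < L θ) → θh ∈ Metric.ball θ₀ ρ →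
      (∀ θ ∈ Θ, ρ ≤ dist θ θ₀ → L θ ≤ L θh * Real.exp (-(N * δ))) →
      (∀ θ ∈ Metric.closedBall θ₀ (2 * ρ), L θh * Real.exp (-(N * (C * ‖θ - θh‖ ^ 2))) ≤ L θ ∧
        L θ ≤ L θh * Real.exp (-(N * (c * ‖θ - θh‖ ^ 2)))) →
      0 < ∫ θ in Θ, L θ * π θ ∧
        |Real.log (∫ θ in Θ, L θ * π θ) - (Real.log (L θh) - 1 / 2 * (d : ℝ) * Real.log N)|
          ≤ K := by
  set v₀ : ℝ := (volume : Measure (RVec d)).real (Metric.ball 0 1) with hv₀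
  have hv₀pos : 0 < v₀ := by
    rw [hv₀, Measure.real, ENNReal.toReal_pos_iff]
    exact ⟨Metric.measure_ball_pos _ _ one_pos, measure_ball_lt_top⟩
  set r₀ : ℝ := min ρ 1 with hr₀
  have hr₀pos : 0 < r₀ := lt_min hρ one_pos
  set A₁ : ℝ := a * Real.exp (-C) * (r₀ ^ d * v₀) with hA₁
  set A₂ : ℝ := d.factorial / δ ^ d + |b| * (Real.pi / c) ^ ((d : ℝ) / 2) with hA₂
  have hA₁pos : 0 < A₁ := by positivity
  have hA₂pos : 0 < A₂ := by
    have : 0 < Real.pi / c := by positivity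
    have hf : (0 : ℝ) < d.factorial := by exact_mod_cast d.factorial_pos
    positivity
  refine ⟨max (Real.log A₂) (-Real.log A₁), ?_⟩
  intro N Θ π L θ₀ θh hN hΘ hπ hball hL hLpos hθh hfar hnear
  have hN1 : (1 : ℝ) ≤ N := by exact_mod_cast hN
  have hN0 : (0 : ℝ) < N := by linarith
  have hθh2 : θh ∈ Metric.closedBall θ₀ (2 * ρ) := by
    rw [Metric.mem_ball] at hθh; rw [Metric.mem_closedBall]; linarith
  have hθhΘ := (hball θh hθh2).1
  have hM := hLpos θh hθhΘ
  set R : ℝ := (N : ℝ) ^ (-((d : ℝ) / 2)) with hR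
  have hRpos : 0 < R := Real.rpow_pos_of_pos hN0 _
  have hπint : IntegrableOn π Θ := by
    refine ⟨hπ.measurable.aestronglyMeasurable, ?_⟩
    rw [hasFiniteIntegral_iff_ofReal (Eventually.of_forall hπ.nonneg), hπ.lintegral_eq_one]
    exact ENNReal.one_lt_top
  have hπone : ∫ θ in Θ, π θ = 1 := by
    rw [integral_eq_lintegral_of_nonneg_ae (Eventually.of_forall hπ.nonneg)
      hπ.measurable.aestronglyMeasurable, hπ.lintegral_eq_one, ENNReal.toReal_one]
  obtain ⟨hGint, hGval⟩ := integral_exp_neg_mul_sq_dist hc hN θh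
  -- the pointwise bound behind the upper estimate
  have hup : ∀ θ ∈ Θ, L θ * π θ ≤ L θh * (Real.exp (-(N * δ)) * π θ
      + |b| * Real.exp (-(N * (c * ‖θ - θh‖ ^ 2)))) := by
    intro θ hθ
    have hπ0 := hπ.nonneg θ
    rcases le_or_gt ρ (dist θ θ₀) with h | h
    · calc L θ * π θ ≤ (L θh * Real.exp (-(N * δ))) * π θ := by
            gcongr; exact hfar θ hθ h
        _ ≤ _ := by
            rw [mul_assoc]
            gcongr
            have : 0 ≤ |b| * Real.exp (-(N * (c * ‖θ - θh‖ ^ 2))) := by positivity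
            linarith
    · have hθ2 : θ ∈ Metric.closedBall θ₀ (2 * ρ) := by
        rw [Metric.mem_closedBall]; linarith
      calc L θ * π θ ≤ (L θh * Real.exp (-(N * (c * ‖θ - θh‖ ^ 2)))) * |b| := by
            gcongr
            · exact (hnear θ hθ2).2
            · exact (hball θ hθ2).2.2.trans (le_abs_self b)
        _ ≤ _ := by
            rw [mul_assoc]
            gcongr
            have : 0 ≤ Real.exp (-(N * δ)) * π θ := by positivity
            linarith
  have hdom : IntegrableOn (fun θ => L θh * (Real.exp (-(N * δ)) * π θ
      + |b| * Real.exp (-(N * (c * ‖θ - θh‖ ^ 2))))) Θ :=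
    ((hπint.const_mul _).add (hGint.integrableOn.const_mul _)).const_mul _
  have hint : IntegrableOn (fun θ => L θ * π θ) Θ := by
    refine Integrable.mono' hdom
      ((hL.aestronglyMeasurable hΘ).mul hπ.measurable.aestronglyMeasurable) ?_
    filter_upwards [ae_restrict_mem hΘ] with θ hθ
    rw [Real.norm_eq_abs, abs_of_nonneg (mul_nonneg (hLpos θ hθ).le (hπ.nonneg θ))]
    exact hup θ hθ
  have hupper : ∫ θ in Θ, L θ * π θ ≤ L θh * (A₂ * R) := by
    calc ∫ θ in Θ, L θ * π θ ≤ ∫ θ in Θ, L θh * (Real.exp (-(N * δ)) * π θ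
          + |b| * Real.exp (-(N * (c * ‖θ - θh‖ ^ 2)))) := setIntegral_mono_on hint hdom hΘ hup
      _ = L θh * (Real.exp (-(N * δ))
          + |b| * ∫ θ in Θ, Real.exp (-(N * (c * ‖θ - θh‖ ^ 2)))) := by
          rw [integral_const_mul, integral_add (hπint.const_mul _)
            (hGint.integrableOn.const_mul _), integral_const_mul, integral_const_mul, hπone,
            mul_one]
      _ ≤ L θh * ((d.factorial / δ ^ d) * R + |b| * ((Real.pi / c) ^ ((d : ℝ) / 2) * R)) := by
          gcongr
          · exact exp_neg_mul_le_rpow d hδ hN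
          · rw [← hGval]
            exact setIntegral_le_integral hGint (Eventually.of_forall fun _ => (Real.exp_pos _).le)
      _ = L θh * (A₂ * R) := by rw [hA₂]; ring
  -- the lower estimate only uses a ball of radius of order `N ^ (-1 / 2)` around `θh`
  set r : ℝ := r₀ * (N : ℝ) ^ (-(1 / 2) : ℝ) with hr
  have hs1 : (N : ℝ) ^ (-(1 / 2) : ℝ) ≤ 1 := Real.rpow_le_one_of_one_le_of_nonpos hN1 (by norm_num)
  have hs0 : 0 < (N : ℝ) ^ (-(1 / 2) : ℝ) := Real.rpow_pos_of_pos hN0 _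
  have hr0 : 0 ≤ r := by positivity
  have hrρ : r ≤ ρ := by
    calc r ≤ r₀ * 1 := by rw [hr]; gcongr
      _ ≤ ρ := by rw [mul_one]; exact min_le_left _ _
  have hNr : (N : ℝ) * r ^ 2 ≤ 1 := by
    have h1 : ((N : ℝ) ^ (-(1 / 2) : ℝ)) ^ 2 = (N : ℝ)⁻¹ := by
      rw [rpow_neg_half_pow 2 hN0.le]
      norm_num [Real.rpow_neg_one]
    have h2 : r₀ ^ 2 ≤ 1 := pow_le_one₀ hr₀pos.le (min_le_right _ _)
    rw [hr, mul_pow, h1]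
    field_simp
    exact h2
  have hsub : Metric.closedBall θh r ⊆ Metric.closedBall θ₀ (2 * ρ) := by
    intro θ hθ
    rw [Metric.mem_closedBall] at *
    rw [Metric.mem_ball] at hθh
    linarith [dist_triangle θ θh θ₀]
  have hlower : L θh * (A₁ * R) ≤ ∫ θ in Θ, L θ * π θ := by
    have hvol : (volume : Measure (RVec d)).real (Metric.closedBall θh r) = r ^ d * v₀ := by
      rw [Measure.real, Measure.addHaar_closedBall _ _ hr0, finrank_euclideanSpace,
        Fintype.card_fin, ENNReal.toReal_mul, ENNReal.toReal_ofReal (by positivity)]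
      rfl
    calc L θh * (A₁ * R)
        = (volume : Measure (RVec d)).real (Metric.closedBall θh r)
            • (L θh * Real.exp (-C) * a) := by
          rw [hvol, hA₁, hR, hr, mul_pow, rpow_neg_half_pow d hN0.le, smul_eq_mul]
          ring
      _ = ∫ θ in Metric.closedBall θh r, L θh * Real.exp (-C) * a := by
          rw [setIntegral_const]
      _ ≤ ∫ θ in Metric.closedBall θh r, L θ * π θ := by
          refine setIntegral_mono_on (integrableOn_const measure_closedBall_lt_top.ne)
            (hint.mono_set fun θ hθ => (hball θ (hsub hθ)).1) Metric.isClosed_closedBall.measurableSet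
            ?_
          intro θ hθ
          have hθ' := hsub hθ
          have h1 : Real.exp (-C) ≤ Real.exp (-(N * (C * ‖θ - θh‖ ^ 2))) := by
            rw [Real.exp_le_exp, neg_le_neg_iff]
            rw [Metric.mem_closedBall, dist_eq_norm] at hθ
            calc (N : ℝ) * (C * ‖θ - θh‖ ^ 2) ≤ N * (C * r ^ 2) := by gcongr
              _ = C * (N * r ^ 2) := by ring
              _ ≤ C * 1 := by gcongr
              _ = C := mul_one C
          have h2 : L θh * Real.exp (-C) ≤ L θ := le_trans (by gcongr) (hnear θ hθ').1
          have := (hLpos θ (hball θ hθ').1).le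
          gcongr
          exact (hball θ hθ').2.1
      _ ≤ ∫ θ in Θ, L θ * π θ := by
          refine setIntegral_mono_set hint ?_ ?_
          · filter_upwards [ae_restrict_mem hΘ] with θ hθ
            exact mul_nonneg (hLpos θ hθ).le (hπ.nonneg θ)
          · exact Eventually.of_forall fun θ hθ => (hball θ (hsub hθ)).1
  have hpos : 0 < ∫ θ in Θ, L θ * π θ := lt_of_lt_of_le (by positivity) hlower
  refine ⟨hpos, ?_⟩
  have hlogR : Real.log R = -(1 / 2 * (d : ℝ) * Real.log N) := by
    rw [hR, Real.log_rpow hN0]; ring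
  have hl := Real.log_le_log (by positivity) hlower
  have hu := Real.log_le_log hpos hupper
  rw [Real.log_mul hM.ne' (by positivity), Real.log_mul (by positivity) hRpos.ne', hlogR] at hl hu
  rw [abs_le]
  have m1 := le_max_left (Real.log A₂) (-Real.log A₁)
  have m2 := le_max_right (Real.log A₂) (-Real.log A₁)
  constructor <;> linarith

/-! ### From the mean log likelihood to the marginal likelihood -/

/-- The log likelihood of the first `N` observations, divided by `N`. -/
def meanLogLik {α β : Type*} (g : α → β → ℝ) (z : ℕ → α) (N : ℕ) (θ : β) : ℝ :=
  (N : ℝ)⁻¹ * ∑ n ∈ Finset.range N, Real.log (g (z n) θ)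

lemma likelihood_eq_exp {α β : Type*} {g : α → β → ℝ} {z : ℕ → α} {θ : β}
    (hg : ∀ n, 0 < g (z n) θ) {N : ℕ} (hN : 1 ≤ N) :
    likelihood g z N θ = Real.exp (N * meanLogLik g z N θ) := by
  have hN0 : (N : ℝ) ≠ 0 := by positivity
  rw [meanLogLik, mul_inv_cancel_left₀ hN0, Real.exp_sum, likelihood]
  exact Finset.prod_congr rfl fun n _ => (Real.exp_log (hg n)).symm

lemma isMaxOn_likelihood_iff {α β : Type*} {g : α → β → ℝ} {Θ : Set β} {z : ℕ → α} {θ : β}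
    (hg : ∀ n, ∀ θ ∈ Θ, 0 < g (z n) θ) {N : ℕ} (hN : 1 ≤ N) (hθ : θ ∈ Θ) :
    IsMaxOn (likelihood g z N) Θ θ ↔ IsMaxOn (meanLogLik g z N) Θ θ := by
  have hN0 : (0 : ℝ) < N := by positivity
  simp only [isMaxOn_iff]
  refine forall₂_congr fun t ht => ?_
  rw [likelihood_eq_exp (fun n => hg n t ht) hN, likelihood_eq_exp (fun n => hg n θ hθ) hN,
    Real.exp_le_exp, mul_le_mul_iff_right₀ hN0]

/-- A prior density is bounded, and bounded away from zero, on compact subsets of the interior. -/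
lemma IsPrior.exists_bounds {d : ℕ} {Θ : Set (RVec d)} {π : RVec d → ℝ} (hπ : IsPrior Θ π)
    {K : Set (RVec d)} (hK : IsCompact K) (hKΘ : K ⊆ interior Θ) :
    ∃ a b : ℝ, 0 < a ∧ ∀ θ ∈ K, a ≤ π θ ∧ π θ ≤ b := by
  refine hK.induction_on (p := fun s => ∃ a b : ℝ, 0 < a ∧ ∀ θ ∈ s, a ≤ π θ ∧ π θ ≤ b)
    ⟨1, 1, one_pos, by simp⟩ ?_ ?_ ?_
  · rintro s t hst ⟨a, b, ha, h⟩
    exact ⟨a, b, ha, fun θ hθ => h θ (hst hθ)⟩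
  · rintro s t ⟨a, b, ha, h⟩ ⟨a', b', ha', h'⟩
    refine ⟨min a a', max b b', lt_min ha ha', ?_⟩
    rintro θ (hθ | hθ)
    · exact ⟨(min_le_left _ _).trans (h θ hθ).1, (h θ hθ).2.trans (le_max_left _ _)⟩
    · exact ⟨(min_le_right _ _).trans (h' θ hθ).1, (h' θ hθ).2.trans (le_max_right _ _)⟩
  · intro θ hθ
    obtain ⟨a, b, ha, h⟩ := hπ.locally_bounded θ (hKΘ hθ)
    exact ⟨_, mem_nhdsWithin_of_mem_nhds h, a, b, ha, fun t ht => ht⟩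

/-- Maximum likelihood estimates exist, and at each of them the Bayesian likelihood is positive and
is approximated by the evidence up to the error `K` on the logarithmic scale. -/
def EvidenceApprox {α : Type*} {d : ℕ} (g : α → RVec d → ℝ) (Θ : Set (RVec d)) (π : RVec d → ℝ)
    (K : ℝ) (z : ℕ → α) (N : ℕ) : Prop :=
  (∃ θ, IsMLE g Θ z N θ) ∧ 0 < marginalLikelihood g Θ π z N ∧ ∀ θ, IsMLE g Θ z N θ →
    |Real.log (marginalLikelihood g Θ π z N)
      - (Real.log (likelihood g z N θ) - 1 / 2 * (d : ℝ) * Real.log N)| ≤ K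

/-- If the mean log likelihood is smaller than at `θ₀` by at least `δ` outside the ball of radius
`ρ` around `θ₀`, and falls off quadratically around each of its maximizers, then the evidence
approximates the Bayesian likelihood with an error controlled by the constants alone. -/
theorem exists_evidenceApprox {α : Type*} {d : ℕ} {g : α → RVec d → ℝ} {Θ : Set (RVec d)}
    {π : RVec d → ℝ} (hΘ : MeasurableSet Θ) (hπ : IsPrior Θ π) {θ₀ : RVec d} {c C δ ρ : ℝ}
    (hc : 0 < c) (hC : 0 ≤ C) (hδ : 0 < δ) (hρ : 0 < ρ)
    (hball : Metric.closedBall θ₀ (2 * ρ) ⊆ interior Θ) :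
    ∃ K : ℝ, ∀ (z : ℕ → α) (N : ℕ), (∀ n, ∀ θ ∈ Θ, 0 < g (z n) θ) →
      (∀ n, ContinuousOn (g (z n)) Θ) → 1 ≤ N →
      (∀ θ ∈ Θ, ρ ≤ dist θ θ₀ → meanLogLik g z N θ ≤ meanLogLik g z N θ₀ - δ) →
      (∀ t ∈ Metric.ball θ₀ ρ, IsMaxOn (meanLogLik g z N) Θ t →
        ∀ θ ∈ Metric.closedBall θ₀ (2 * ρ),
          c * ‖θ - t‖ ^ 2 ≤ meanLogLik g z N t - meanLogLik g z N θ ∧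
          meanLogLik g z N t - meanLogLik g z N θ ≤ C * ‖θ - t‖ ^ 2) →
      EvidenceApprox g Θ π K z N := by
  obtain ⟨a, b, ha, hab⟩ := hπ.exists_bounds (isCompact_closedBall θ₀ (2 * ρ)) hball
  obtain ⟨K, hK⟩ := laplace_bounds (d := d) (b := b) ha hc hC hδ hρ
  refine ⟨K, ?_⟩
  intro z N hpos hcont hN hfar hcurv
  have hN0 : (0 : ℝ) < N := by positivity
  have hballΘ : Metric.closedBall θ₀ (2 * ρ) ⊆ Θ := hball.trans interior_subset
  have hθ₀Θ : θ₀ ∈ Θ := hballΘ (Metric.mem_closedBall_self (by positivity))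
  have hlik : ∀ θ ∈ Θ, likelihood g z N θ = Real.exp (N * meanLogLik g z N θ) :=
    fun θ hθ => likelihood_eq_exp (fun n => hpos n θ hθ) hN
  have hLcont : ContinuousOn (likelihood g z N) Θ :=
    continuousOn_finsetProd _ fun n _ => hcont n
  have hLpos : ∀ θ ∈ Θ, 0 < likelihood g z N θ := fun θ hθ => by
    rw [hlik θ hθ]; exact Real.exp_pos _
  have hmain : ∀ t, IsMLE g Θ z N t → 0 < marginalLikelihood g Θ π z N ∧
      |Real.log (marginalLikelihood g Θ π z N)
        - (Real.log (likelihood g z N t) - 1 / 2 * (d : ℝ) * Real.log N)| ≤ K := by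
    rintro t ⟨htΘ, ht⟩
    have ht' := (isMaxOn_likelihood_iff hpos hN htΘ).1 ht
    have htball : t ∈ Metric.ball θ₀ ρ := by
      rw [Metric.mem_ball]
      by_contra! h
      have h1 := hfar t htΘ h
      have h2 : meanLogLik g z N θ₀ ≤ meanLogLik g z N t := ht' hθ₀Θ
      linarith
    refine hK N Θ π (likelihood g z N) θ₀ t hN hΘ hπ
      (fun θ hθ => ⟨hballΘ hθ, hab θ hθ⟩) hLcont hLpos htball ?_ ?_
    · intro θ hθ h
      rw [hlik θ hθ, hlik t htΘ, ← Real.exp_add, Real.exp_le_exp]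
      have h1 := hfar θ hθ h
      have h2 : meanLogLik g z N θ₀ ≤ meanLogLik g z N t := ht' hθ₀Θ
      have h3 : (N : ℝ) * meanLogLik g z N θ ≤ N * (meanLogLik g z N t - δ) := by
        gcongr; linarith
      linarith
    · intro θ hθ
      obtain ⟨h1, h2⟩ := hcurv t htball ht' θ hθ
      rw [hlik θ (hballΘ hθ), hlik t htΘ, ← Real.exp_add, ← Real.exp_add, Real.exp_le_exp,
        Real.exp_le_exp]
      have h3 := mul_le_mul_of_nonneg_left h1 hN0.le
      have h4 := mul_le_mul_of_nonneg_left h2 hN0.le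
      constructor <;> linarith
  have hex : ∃ t, IsMLE g Θ z N t := by
    have hsub : Metric.closedBall θ₀ ρ ⊆ Θ :=
      (Metric.closedBall_subset_closedBall (by linarith)).trans hballΘ
    obtain ⟨t, ht, hmax⟩ := (isCompact_closedBall θ₀ ρ).exists_isMaxOn
      ⟨θ₀, Metric.mem_closedBall_self hρ.le⟩ (hLcont.mono hsub)
    refine ⟨t, hsub ht, fun θ hθ => ?_⟩
    rcases le_or_gt (dist θ θ₀) ρ with h | h
    · exact hmax h
    · refine le_trans ?_ (isMaxOn_iff.1 hmax θ₀ (Metric.mem_closedBall_self hρ.le))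
      rw [hlik θ hθ, hlik θ₀ hθ₀Θ, Real.exp_le_exp]
      gcongr
      linarith [hfar θ hθ h.le]
  obtain ⟨t, ht⟩ := hex
  exact ⟨⟨t, ht⟩, (hmain t ht).1, fun θ hθ => (hmain θ hθ).2⟩

/-! ### A uniform strong law of large numbers -/

lemma strong_law_comp {Ω α E : Type*} [MeasurableSpace Ω] {P : Measure Ω}
    [MeasurableSpace α] {μ : Measure α} {Z : ℕ → Ω → α} (hZ : ∀ n, Measurable (Z n))
    (hind : Pairwise fun i j => IndepFun (Z i) (Z j) P) (hlaw : ∀ n, P.map (Z n) = μ)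
    [NormedAddCommGroup E] [NormedSpace ℝ E] [CompleteSpace E] [MeasurableSpace E] [BorelSpace E]
    {G : α → E} (hG : Measurable G) (hGi : Integrable G μ) :
    ∀ᵐ ω ∂P, Tendsto (fun N : ℕ => (N : ℝ)⁻¹ • ∑ n ∈ Finset.range N, G (Z n ω)) atTop
      (𝓝 (∫ z, G z ∂μ)) := by
  have hi : Integrable (fun ω => G (Z 0 ω)) P := by
    rw [← hlaw 0] at hGi
    exact hGi.comp_measurable (hZ 0)
  have h := strong_law_ae (μ := P) (fun n ω => G (Z n ω)) hi
    (fun i j hij => (hind hij).comp hG hG)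
    (fun n => by
      refine IdentDistrib.comp (u := G) ⟨(hZ n).aemeasurable, (hZ 0).aemeasurable, ?_⟩ hG
      rw [hlaw n, hlaw 0])
  have e : ∫ ω, G (Z 0 ω) ∂P = ∫ z, G z ∂μ := by
    rw [← hlaw 0] at hGi ⊢
    rw [integral_map (hZ 0).aemeasurable hGi.aestronglyMeasurable]
  rwa [e] at h

/-- For `g` jointly continuous on a product of compact sets, sample means of `g (·, θ)` converge
uniformly in `θ`. This is the strong law for the random elements `g (Z n, ·)` of the Banach space of
continuous functions on `K`. -/
theorem uniform_strong_law {Ω α β F : Type*} [MeasurableSpace Ω] {P : Measure Ω}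
    [MeasurableSpace α] [TopologicalSpace α] [OpensMeasurableSpace α] {μ : Measure α}
    [IsFiniteMeasure μ] {Z : ℕ → Ω → α} (hZ : ∀ n, Measurable (Z n))
    (hind : Pairwise fun i j => IndepFun (Z i) (Z j) P) (hlaw : ∀ n, P.map (Z n) = μ)
    {S : Set α} (hS : IsCompact S) (hSm : MeasurableSet S) (hμS : ∀ᵐ z ∂μ, z ∈ S)
    [TopologicalSpace β] {K : Set β} (hK : IsCompact K)
    [NormedAddCommGroup F] [NormedSpace ℝ F] [CompleteSpace F]
    {g : α → β → F} (hg : ContinuousOn (Function.uncurry g) (S ×ˢ K)) :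
    ContinuousOn (fun θ => ∫ z, g z θ ∂μ) K ∧
    ∀ᵐ ω ∂P, ∀ ε > 0, ∀ᶠ N : ℕ in atTop, ∀ θ ∈ K,
      ‖(N : ℝ)⁻¹ • ∑ n ∈ Finset.range N, g (Z n ω) θ - ∫ z, g z θ ∂μ‖ ≤ ε := by
  classical
  have hKc : CompactSpace K := isCompact_iff_compactSpace.1 hK
  let _ : MeasurableSpace C(K, F) := borel _
  have hborel : BorelSpace C(K, F) := ⟨rfl⟩
  -- `G z = g (z, ·)` on `S`; off `S`, where `g` need not be continuous, the value `0` is harmless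
  have hslice : ∀ z ∈ S, Continuous fun θ : K => g z θ := fun z hz => by
    have : ContinuousOn (fun θ => g z θ) K :=
      hg.comp (f := fun θ => (z, θ)) (by fun_prop) fun θ hθ => ⟨hz, hθ⟩
    exact continuousOn_iff_continuous_domRestrict.1 this
  set G : α → C(K, F) := fun z => if hz : z ∈ S then ⟨_, hslice z hz⟩ else 0 with hGdef
  have hGS : ∀ z ∈ S, ∀ θ : K, G z θ = g z θ := fun z hz θ => by
    simp [hGdef, hz]
  have hGc : ContinuousOn G S := by
    refine ContinuousMap.continuousOn_of_continuousOn_uncurry G ?_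
    have : ContinuousOn (fun w : α × K => Function.uncurry g (w.1, (w.2 : β))) (S ×ˢ Set.univ) :=
      hg.comp (f := fun w : α × K => (w.1, (w.2 : β))) (by fun_prop) fun w hw => ⟨hw.1, w.2.2⟩
    exact this.congr fun w hw => hGS w.1 hw.1 w.2
  have hGm : Measurable G := by
    have h : S.piecewise G (fun _ => 0) = G := by
      ext1 z
      by_cases hz : z ∈ S <;> simp [hGdef, hz]
    rw [← h]
    exact hGc.measurable_piecewise continuousOn_const hSm
  have hμr : μ.restrict S = μ := Measure.restrict_eq_self_of_ae_mem hμS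
  have hGi : Integrable G μ := by
    obtain ⟨B, hB⟩ := hS.exists_bound_of_continuousOn hGc
    refine ⟨?_, HasFiniteIntegral.of_bounded (C := B) ?_⟩
    · rw [← hμr]
      exact hGc.aestronglyMeasurable_of_isCompact hS hSm
    · filter_upwards [hμS] with z hz using hB z hz
  have hev : ∀ θ : K, (∫ z, G z ∂μ) θ = ∫ z, g z θ ∂μ := fun θ => by
    have h := (ContinuousMap.evalCLM ℝ θ : C(K, F) →L[ℝ] F).integral_comp_comm hGi
    simp only [ContinuousMap.evalCLM_apply] at h
    rw [← h]
    refine integral_congr_ae ?_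
    filter_upwards [hμS] with z hz using hGS z hz θ
  refine ⟨?_, ?_⟩
  · rw [continuousOn_iff_continuous_domRestrict]
    exact (∫ z, G z ∂μ).continuous.congr hev
  · have hZS : ∀ᵐ ω ∂P, ∀ n, Z n ω ∈ S := by
      rw [ae_all_iff]
      intro n
      refine ae_of_ae_map (hZ n).aemeasurable (p := fun z => z ∈ S) ?_
      rwa [hlaw n]
    filter_upwards [strong_law_comp hZ hind hlaw hGm hGi, hZS] with ω hω hωS ε hε
    filter_upwards [(Metric.tendsto_nhds.1 hω) ε hε] with N hN θ hθ
    rw [dist_eq_norm] at hN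
    have h1 := (ContinuousMap.norm_coe_le_norm
      ((N : ℝ)⁻¹ • ∑ n ∈ Finset.range N, G (Z n ω) - ∫ z, G z ∂μ) ⟨θ, hθ⟩).trans hN.le
    rwa [ContinuousMap.sub_apply, hev, ContinuousMap.smul_apply, ContinuousMap.sum_apply,
      Finset.sum_congr rfl fun n _ => hGS _ (hωS n) ⟨θ, hθ⟩] at h1

/-! ### Concave functions, compactness, and second-order estimates -/

/-- A gap between the value of a concave function at the centre of a ball and its values on the
sphere persists outside the ball. -/
lemma concave_gap_outside_ball {E : Type*} [NormedAddCommGroup E] [NormedSpace ℝ E] {Θ : Set E}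
    {g : E → ℝ} (hg : ConcaveOn ℝ Θ g) {θ₀ : E} (hθ₀ : θ₀ ∈ Θ) {ρ δ : ℝ} (hρ : 0 < ρ)
    (hδ : 0 ≤ δ) (hsphere : ∀ θ ∈ Metric.sphere θ₀ ρ, g θ ≤ g θ₀ - δ) :
    ∀ θ ∈ Θ, ρ ≤ dist θ θ₀ → g θ ≤ g θ₀ - δ := by
  intro θ hθ h
  have hd : 0 < dist θ θ₀ := by linarith
  set t : ℝ := ρ / dist θ θ₀ with ht
  have ht0 : 0 < t := by positivity
  have ht1 : t ≤ 1 := (div_le_one hd).2 h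
  have hs : (1 - t) • θ₀ + t • θ ∈ Metric.sphere θ₀ ρ := by
    have e : (1 - t) • θ₀ + t • θ - θ₀ = t • (θ - θ₀) := by module
    rw [mem_sphere_iff_norm, e, norm_smul, Real.norm_of_nonneg ht0.le, ← dist_eq_norm, ht]
    field_simp
  have h1 := hg.2 hθ₀ hθ (sub_nonneg.2 ht1) ht0.le (by ring)
  have h2 := hsphere _ hs
  simp only [smul_eq_mul] at h1
  by_contra! h3
  have h4 : t * (g θ₀ - δ) < t * g θ := by gcongr
  have h5 : 0 ≤ (1 - t) * δ := mul_nonneg (sub_nonneg.2 ht1) hδ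
  linarith

lemma exists_le_neg_of_isCompact {E : Type*} [TopologicalSpace E] {s : Set E} (hs : IsCompact s)
    {f : E → ℝ} (hf : ContinuousOn f s) (h : ∀ x ∈ s, f x < 0) :
    ∃ c > 0, ∀ x ∈ s, f x ≤ -c := by
  rcases s.eq_empty_or_nonempty with rfl | hne
  · exact ⟨1, one_pos, by simp⟩
  · obtain ⟨x, hx, hmax⟩ := hs.exists_isMaxOn hne hf
    exact ⟨-f x, by linarith [h x hx], fun y hy => by
      have := isMaxOn_iff.1 hmax y hy; linarith⟩

lemma sub_le_of_second_deriv_le {φ φ' φ'' : ℝ → ℝ} {M : ℝ}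
    (h1 : ∀ t ∈ Set.Icc (0 : ℝ) 1, HasDerivAt φ (φ' t) t)
    (h2 : ∀ t ∈ Set.Icc (0 : ℝ) 1, HasDerivAt φ' (φ'' t) t) (h0 : φ' 0 = 0)
    (hM : ∀ t ∈ Set.Icc (0 : ℝ) 1, φ'' t ≤ M) : φ 1 - φ 0 ≤ M / 2 := by
  have d1 : ∀ t ∈ Set.Icc (0 : ℝ) 1, HasDerivAt (fun t => φ' t - M * t) (φ'' t - M) t :=
    fun t ht => (h2 t ht).fun_sub (by simpa using (hasDerivAt_id t).const_mul M)
  have d0 : ∀ t ∈ Set.Icc (0 : ℝ) 1,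
      HasDerivAt (fun t => φ t - M / 2 * t ^ 2) (φ' t - M * t) t := fun t ht =>
    ((h1 t ht).fun_sub ((hasDerivAt_pow 2 t).const_mul (M / 2))).congr_deriv (by
      rw [Nat.add_one_sub_one, pow_one]; push_cast; ring)
  have hsub : interior (Set.Icc (0 : ℝ) 1) ⊆ Set.Icc 0 1 := interior_subset
  have a1 : AntitoneOn (fun t => φ' t - M * t) (Set.Icc 0 1) := by
    refine antitoneOn_of_deriv_nonpos (convex_Icc 0 1)
      (fun t ht => (d1 t ht).continuousAt.continuousWithinAt)
      (fun t ht => (d1 t (hsub ht)).differentiableAt.differentiableWithinAt) fun t ht => ?_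
    rw [(d1 t (hsub ht)).deriv]
    linarith [hM t (hsub ht)]
  have z0 : (0 : ℝ) ∈ Set.Icc (0 : ℝ) 1 := by simp
  have z1 : (1 : ℝ) ∈ Set.Icc (0 : ℝ) 1 := by simp
  have n1 : ∀ t ∈ Set.Icc (0 : ℝ) 1, φ' t - M * t ≤ 0 := fun t ht => by
    have := a1 z0 ht ht.1
    simpa [h0] using this
  have a0 : AntitoneOn (fun t => φ t - M / 2 * t ^ 2) (Set.Icc 0 1) := by
    refine antitoneOn_of_deriv_nonpos (convex_Icc 0 1)
      (fun t ht => (d0 t ht).continuousAt.continuousWithinAt)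
      (fun t ht => (d0 t (hsub ht)).differentiableAt.differentiableWithinAt) fun t ht => ?_
    rw [(d0 t (hsub ht)).deriv]
    exact n1 t (hsub ht)
  have := a0 z0 z1 zero_le_one
  simp only [ne_eq, OfNat.ofNat_ne_zero, not_false_eq_true, zero_pow, mul_zero, sub_zero, one_pow,
    mul_one] at this
  linarith

lemma hasDerivAt_along_line {E : Type*} [NormedAddCommGroup E] [NormedSpace ℝ E] {U : Set E}
    (hU : IsOpen U) {u : E → ℝ} (hu : ContDiffOn ℝ 2 u U) {x h : E} {t : ℝ} (ht : x + t • h ∈ U) :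
    HasDerivAt (fun t : ℝ => u (x + t • h)) (fderiv ℝ u (x + t • h) h) t ∧
    HasDerivAt (fun t : ℝ => fderiv ℝ u (x + t • h) h)
      (iteratedFDeriv ℝ 2 u (x + t • h) ![h, h]) t := by
  have hline : HasDerivAt (fun t : ℝ => x + t • h) h t := by
    simpa using ((hasDerivAt_id t).smul_const h).const_add x
  have hat : ContDiffAt ℝ 2 u (x + t • h) := hu.contDiffAt (hU.mem_nhds ht)
  refine ⟨(hat.differentiableAt (by norm_num)).hasFDerivAt.comp_hasDerivAt t hline, ?_⟩
  have h2 : DifferentiableAt ℝ (fderiv ℝ u) (x + t • h) :=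
    (hat.fderiv_right (m := 1) (by norm_num)).differentiableAt (by norm_num)
  rw [iteratedFDeriv_two_apply]
  exact (((ContinuousLinearMap.apply ℝ ℝ h).hasFDerivAt.comp _ h2.hasFDerivAt).comp_hasDerivAt t
    hline)

/-- At an interior maximizer the mean log likelihood falls off quadratically, at rates controlled by
bounds on the sample mean of the second derivatives. -/
lemma meanLogLik_quadratic {α : Type*} {d : ℕ} {g : α → RVec d → ℝ} {Θ U : Set (RVec d)}
    {z : ℕ → α} {N : ℕ} (hU : IsOpen U) (hUΘ : U ⊆ Θ) {B : Set (RVec d)} (hB : Convex ℝ B)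
    (hBU : B ⊆ U) (hg : ∀ n, ContDiffOn ℝ 2 (fun θ => Real.log (g (z n) θ)) U) {c C : ℝ}
    (hH : ∀ θ ∈ B, ∀ v ∈ Metric.sphere (0 : RVec d) 1,
      (N : ℝ)⁻¹ * ∑ n ∈ Finset.range N,
        iteratedFDeriv ℝ 2 (fun θ => Real.log (g (z n) θ)) θ ![v, v] ∈ Set.Icc (-C) (-c))
    {t θ : RVec d} (ht : t ∈ B) (hmax : IsMaxOn (meanLogLik g z N) Θ t) (hθ : θ ∈ B) :
    c / 2 * ‖θ - t‖ ^ 2 ≤ meanLogLik g z N t - meanLogLik g z N θ ∧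
      meanLogLik g z N t - meanLogLik g z N θ ≤ C / 2 * ‖θ - t‖ ^ 2 := by
  rcases eq_or_ne θ t with rfl | hne
  · simp
  set h : RVec d := θ - t with hh
  have hh0 : ‖h‖ ≠ 0 := by rw [hh, norm_ne_zero_iff, sub_ne_zero]; exact hne
  have hseg : ∀ s ∈ Set.Icc (0 : ℝ) 1, t + s • h ∈ B := fun s hs =>
    hB.add_smul_sub_mem ht hθ hs
  set φ : ℝ → ℝ := fun s => meanLogLik g z N (t + s • h) with hφ
  set φ' : ℝ → ℝ := fun s => (N : ℝ)⁻¹ * ∑ n ∈ Finset.range N,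
    fderiv ℝ (fun θ => Real.log (g (z n) θ)) (t + s • h) h with hφ'
  set φ'' : ℝ → ℝ := fun s => (N : ℝ)⁻¹ * ∑ n ∈ Finset.range N,
    iteratedFDeriv ℝ 2 (fun θ => Real.log (g (z n) θ)) (t + s • h) ![h, h] with hφ''
  have d1 : ∀ s ∈ Set.Icc (0 : ℝ) 1, HasDerivAt φ (φ' s) s := fun s hs =>
    (HasDerivAt.fun_sum fun n _ =>
      (hasDerivAt_along_line hU (hg n) (hBU (hseg s hs))).1).const_mul _
  have d2 : ∀ s ∈ Set.Icc (0 : ℝ) 1, HasDerivAt φ' (φ'' s) s := fun s hs =>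
    (HasDerivAt.fun_sum fun n _ =>
      (hasDerivAt_along_line hU (hg n) (hBU (hseg s hs))).2).const_mul _
  have h0 : φ' 0 = 0 := by
    refine IsLocalMax.hasDerivAt_eq_zero ?_ (d1 0 (by simp))
    have hcont : Continuous fun s : ℝ => t + s • h := by fun_prop
    have hev : ∀ᶠ s : ℝ in 𝓝 0, t + s • h ∈ U :=
      hcont.continuousAt.eventually_mem (hU.mem_nhds (by simpa using hBU ht))
    filter_upwards [hev] with s hs
    simp only [hφ, zero_smul, add_zero]
    exact hmax (hUΘ hs)
  have hbd : ∀ s ∈ Set.Icc (0 : ℝ) 1, φ'' s ∈ Set.Icc (-C * ‖h‖ ^ 2) (-c * ‖h‖ ^ 2) := by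
    intro s hs
    have hv : ‖h‖⁻¹ • h ∈ Metric.sphere (0 : RVec d) 1 := by
      rw [mem_sphere_zero_iff_norm, norm_smul, norm_inv, norm_norm, inv_mul_cancel₀ hh0]
    obtain ⟨e1, e2⟩ := hH _ (hseg s hs) _ hv
    have e : ∀ m : ContinuousMultilinearMap ℝ (fun _ : Fin 2 => RVec d) ℝ,
        m ![h, h] = ‖h‖ ^ 2 * m ![‖h‖⁻¹ • h, ‖h‖⁻¹ • h] := by
      intro m
      have h1 := m.map_smul_univ (fun _ => ‖h‖) ![‖h‖⁻¹ • h, ‖h‖⁻¹ • h]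
      simp only [Finset.prod_const, Finset.card_univ, Fintype.card_fin, smul_eq_mul] at h1
      rw [← h1]
      congr 1
      ext1 i
      fin_cases i <;> simp [smul_smul, mul_inv_cancel₀ hh0]
    have e' : φ'' s = ‖h‖ ^ 2 * ((N : ℝ)⁻¹ * ∑ n ∈ Finset.range N,
        iteratedFDeriv ℝ 2 (fun θ => Real.log (g (z n) θ)) (t + s • h)
          ![‖h‖⁻¹ • h, ‖h‖⁻¹ • h]) := by
      simp only [hφ'']
      rw [Finset.sum_congr rfl fun n _ => e _, ← Finset.mul_sum]
      ring
    rw [e']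
    have hp : 0 ≤ ‖h‖ ^ 2 := by positivity
    constructor
    · linarith [mul_le_mul_of_nonneg_left e1 hp]
    · linarith [mul_le_mul_of_nonneg_left e2 hp]
  have u := sub_le_of_second_deriv_le d1 d2 h0 fun s hs => (hbd s hs).2
  have l := sub_le_of_second_deriv_le (φ := fun s => -φ s) (φ' := fun s => -φ' s)
    (φ'' := fun s => -φ'' s) (fun s hs => (d1 s hs).neg) (fun s hs => (d2 s hs).neg)
    (by simp [h0]) (M := C * ‖h‖ ^ 2) fun s hs => by linarith [(hbd s hs).1]
  have p0 : φ 0 = meanLogLik g z N t := by simp [hφ]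
  have p1 : φ 1 = meanLogLik g z N θ := by simp [hφ, hh]
  simp only [p0, p1] at u l
  constructor <;> linarith

lemma concaveOn_meanLogLik {α : Type*} {d : ℕ} {g : α → RVec d → ℝ} {Θ : Set (RVec d)}
    {z : ℕ → α} (hΘ : Convex ℝ Θ) (hg : ∀ n, ConcaveOn ℝ Θ fun θ => Real.log (g (z n) θ)) (N : ℕ) :
    ConcaveOn ℝ Θ (meanLogLik g z N) := by
  have h : ∀ s : Finset ℕ, ConcaveOn ℝ Θ fun θ => ∑ n ∈ s, Real.log (g (z n) θ) := by
    intro s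
    induction s using Finset.induction_on with
    | empty => simpa using concaveOn_const (0 : ℝ) hΘ
    | insert n s hn ih =>
      simp only [Finset.sum_insert hn]
      exact (hg n).add ih
  exact (h _).smul (inv_nonneg.2 (Nat.cast_nonneg N))

/-! ### Regular conditional models -/

/-- For a regular conditional model, the evidence almost surely approximates the Bayesian likelihood
up to a deterministic error. The uniform strong law makes the mean log likelihood inherit from its
expectation the separated maximum at the pseudo-true value and the negative definite Hessian near
it. -/
theorem CondModel.IsRegular.exists_evidenceApprox {Ω : Type*} [MeasurableSpace Ω] {P : Measure Ω}
    {p q : ℕ} {S : Set (RVec p × RVec q)} (hS : IsCompact S) {μ : Measure (RVec p × RVec q)}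
    [IsFiniteMeasure μ] (hμS : ∀ᵐ z ∂μ, z ∈ S) {F : CondModel p q} (hF : F.IsRegular S μ)
    {Z : ℕ → Ω → RVec p × RVec q} (hZ : ∀ n, Measurable (Z n))
    (hind : Pairwise fun i j => IndepFun (Z i) (Z j) P) (hlaw : ∀ n, P.map (Z n) = μ) :
    ∃ K : ℝ, ∀ᵐ ω ∂P, ∀ᶠ N : ℕ in atTop,
      EvidenceApprox F.density F.Θ F.prior K (fun n => Z n ω) N := by
  obtain ⟨θ₀, U, hU, hθ₀U, hUΘ, hmax, hdiff, hcontH, hneg⟩ := hF.pseudo_true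
  have hSm := hS.measurableSet
  have hlog : ContinuousOn (Function.uncurry fun z θ => Real.log (F.density z θ)) (S ×ˢ F.Θ) :=
    hF.continuousOn.log fun w hw => (hF.pos w.1 hw.1 w.2 hw.2).ne'
  have hZS : ∀ᵐ ω ∂P, ∀ n, Z n ω ∈ S := by
    rw [ae_all_iff]
    intro n
    refine ae_of_ae_map (hZ n).aemeasurable (p := fun z => z ∈ S) ?_
    rwa [hlaw n]
  -- the Hessians, as functions of the parameter and of a unit direction
  set D : RVec p × RVec q → RVec F.dim × RVec F.dim → ℝ := fun z w =>
    iteratedFDeriv ℝ 2 (fun θ => Real.log (F.density z θ)) w.1 ![w.2, w.2] with hD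
  obtain ⟨r, hr, hrU⟩ := Metric.isOpen_iff.1 hU θ₀ hθ₀U
  have hr2U : Metric.closedBall θ₀ (r / 2) ⊆ U :=
    (Metric.closedBall_subset_ball (by linarith)).trans hrU
  set K₂ : Set (RVec F.dim × RVec F.dim) := Metric.closedBall θ₀ (r / 2) ×ˢ Metric.sphere 0 1
    with hK₂
  have hK₂c : IsCompact K₂ := (isCompact_closedBall _ _).prod (isCompact_sphere _ _)
  have hDc : ContinuousOn (Function.uncurry D) (S ×ˢ K₂) := by
    have h1 : ContinuousOn (fun w : (RVec p × RVec q) × (RVec F.dim × RVec F.dim) =>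
        iteratedFDeriv ℝ 2 (fun θ => Real.log (F.density w.1 θ)) w.2.1) (S ×ˢ K₂) :=
      hcontH.comp (f := fun w : (RVec p × RVec q) × (RVec F.dim × RVec F.dim) => (w.1, w.2.1))
        (by fun_prop) fun w hw => ⟨hw.1, hr2U hw.2.1⟩
    have h2 : Continuous fun w : (RVec p × RVec q) × (RVec F.dim × RVec F.dim) =>
        (![w.2.2, w.2.2] : Fin 2 → RVec F.dim) := by fun_prop
    exact h1.eval h2.continuousOn
  obtain ⟨hΛ₂c, hΛ₂⟩ := uniform_strong_law hZ hind hlaw hS hSm hμS hK₂c hDc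
  set Λ₂ : RVec F.dim × RVec F.dim → ℝ := fun w => ∫ z, D z w ∂μ with hΛ₂def
  obtain ⟨c₀, hc₀, hc₀le⟩ := exists_le_neg_of_isCompact (isCompact_sphere (0 : RVec F.dim) 1)
    (f := fun v => Λ₂ (θ₀, v))
    (hΛ₂c.comp (f := fun v => (θ₀, v)) (by fun_prop)
      fun v hv => ⟨Metric.mem_closedBall_self (by linarith), hv⟩)
    (fun v hv => hneg v (by rintro rfl; simp at hv))
  obtain ⟨η, hη, hunif⟩ := Metric.uniformContinuousOn_iff.1
    (hK₂c.uniformContinuousOn_of_continuous hΛ₂c) (c₀ / 2) (by linarith)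
  obtain ⟨B₂, hB₂⟩ := hK₂c.exists_bound_of_continuousOn hΛ₂c
  set ρ : ℝ := min (r / 2) (η / 2) / 2 with hρdef
  have hρ : 0 < ρ := by
    have : 0 < min (r / 2) (η / 2) := lt_min (by linarith) (by linarith)
    positivity
  have h2ρ : 2 * ρ = min (r / 2) (η / 2) := by rw [hρdef]; ring
  have h2ρr : 2 * ρ ≤ r / 2 := h2ρ ▸ min_le_left _ _
  have h2ρη : 2 * ρ < η := by
    have : 2 * ρ ≤ η / 2 := h2ρ ▸ min_le_right _ _
    linarith
  have hballr : Metric.closedBall θ₀ (2 * ρ) ⊆ Metric.closedBall θ₀ (r / 2) :=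
    Metric.closedBall_subset_closedBall h2ρr
  have hballU : Metric.closedBall θ₀ (2 * ρ) ⊆ U := hballr.trans hr2U
  have hΛ₂le : ∀ θ ∈ Metric.closedBall θ₀ (2 * ρ), ∀ v ∈ Metric.sphere (0 : RVec F.dim) 1,
      Λ₂ (θ, v) ≤ -(c₀ / 2) := by
    intro θ hθ v hv
    have h1 := hunif (θ, v) ⟨hballr hθ, hv⟩ (θ₀, v) ⟨Metric.mem_closedBall_self (by linarith), hv⟩
      (by
        rw [Prod.dist_eq, dist_self, max_eq_left dist_nonneg]
        exact lt_of_le_of_lt hθ h2ρη)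
    rw [Real.dist_eq] at h1
    have h2 : Λ₂ (θ₀, v) ≤ -c₀ := hc₀le v hv
    linarith [(abs_lt.1 h1).2]
  -- a compact set on which a gap of the mean log likelihood implies the gap on all of `Θ`
  obtain ⟨K₁, hK₁c, hK₁Θ, hθ₀K₁, hK₁⟩ : ∃ K₁ : Set (RVec F.dim), IsCompact K₁ ∧ K₁ ⊆ F.Θ ∧
      θ₀ ∈ K₁ ∧ ∀ (z : ℕ → RVec p × RVec q) (N : ℕ) (δ : ℝ), 0 ≤ δ → (∀ n, z n ∈ S) →
        (∀ θ ∈ K₁, ρ ≤ dist θ θ₀ →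
          meanLogLik F.density z N θ ≤ meanLogLik F.density z N θ₀ - δ) →
        ∀ θ ∈ F.Θ, ρ ≤ dist θ θ₀ →
          meanLogLik F.density z N θ ≤ meanLogLik F.density z N θ₀ - δ := by
    rcases hF.compact_or_concave with h | ⟨hconv, hconc⟩
    · exact ⟨F.Θ, h, subset_rfl, hUΘ hθ₀U, fun z N δ _ _ h => h⟩
    · refine ⟨Metric.closedBall θ₀ ρ, isCompact_closedBall _ _,
        (Metric.closedBall_subset_closedBall (by linarith)).trans (hballU.trans hUΘ),
        Metric.mem_closedBall_self hρ.le, fun z N δ hδ hz h => ?_⟩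
      exact concave_gap_outside_ball (concaveOn_meanLogLik hconv (fun n => hconc _ (hz n)) N)
        (hUΘ hθ₀U) hρ hδ fun θ hθ => h θ (Metric.sphere_subset_closedBall hθ)
          (Metric.mem_sphere.1 hθ).ge
  obtain ⟨hΛc, hΛ⟩ := uniform_strong_law hZ hind hlaw hS hSm hμS hK₁c
    (hlog.mono (Set.prod_mono subset_rfl hK₁Θ))
  set Λ : RVec F.dim → ℝ := fun θ => ∫ z, Real.log (F.density z θ) ∂μ with hΛdef
  obtain ⟨δ₀, hδ₀, hδ₀le⟩ := exists_le_neg_of_isCompact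
    (hK₁c.diff (Metric.isOpen_ball (x := θ₀) (ε := ρ))) (f := fun θ => Λ θ - Λ θ₀)
    ((hΛc.mono Set.sdiff_subset).sub continuousOn_const) (fun θ hθ => by
      refine sub_neg.2 (hmax θ (hK₁Θ hθ.1) ?_)
      rintro rfl
      exact hθ.2 (Metric.mem_ball_self hρ))
  obtain ⟨K, hK⟩ := OptInfo.exists_evidenceApprox (α := RVec p × RVec q) (g := F.density)
    hF.measurableSet hF.prior
    (c := c₀ / 4 / 2) (C := (|B₂| + c₀ / 4) / 2) (δ := δ₀ / 3) (by positivity) (by positivity)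
    (by positivity) hρ (hballU.trans (interior_maximal hUΘ hU))
  refine ⟨K, ?_⟩
  filter_upwards [hΛ₂, hΛ, hZS] with ω h2 h1 hωS
  filter_upwards [h2 (c₀ / 4) (by positivity), h1 (δ₀ / 3) (by positivity),
    eventually_ge_atTop 1] with N hN2 hN1 hN
  refine hK _ N (fun n θ hθ => hF.pos _ (hωS n) θ hθ) (fun n => ?_) hN ?_ ?_
  · exact hF.continuousOn.comp (f := fun θ => (Z n ω, θ)) (by fun_prop) fun θ hθ => ⟨hωS n, hθ⟩
  · refine hK₁ _ N _ (by positivity) hωS fun θ hθ h => ?_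
    have e1 := (abs_le.1 (hN1 θ hθ)).2
    have e2 := (abs_le.1 (hN1 θ₀ hθ₀K₁)).1
    have e3 := hδ₀le θ ⟨hθ, by simpa using h⟩
    simp only [smul_eq_mul] at e1 e2
    simp only [meanLogLik, hΛdef] at *
    linarith
  · intro t ht hmaxt θ hθ
    refine meanLogLik_quadratic hU hUΘ (convex_closedBall θ₀ (2 * ρ)) hballU
      (fun n => hdiff _ (hωS n)) ?_
      (Metric.closedBall_subset_closedBall (by linarith) (Metric.ball_subset_closedBall ht))
      hmaxt hθ
    intro θ hθ v hv
    have e1 := abs_le.1 (hN2 (θ, v) ⟨hballr hθ, hv⟩)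
    have e2 := hΛ₂le θ hθ v hv
    have e3 := (abs_le.1 ((hB₂ (θ, v) ⟨hballr hθ, hv⟩).trans (le_abs_self B₂))).1
    simp only [smul_eq_mul, hD, hΛ₂def] at e1 e2 e3
    constructor
    · linarith [e1.1]
    · linarith [e1.2]

/-! ### Moments of a bounded statistic and the centered partition function -/

section Partition

variable {α : Type*} [MeasurableSpace α] {ν : Measure α} {d : ℕ}
  {T : α → RVec d} {B : ℝ}

/-- `∫ exp(lam' (T - m))`. With `m` the sample moment, the mean log likelihood of the exponential
family of `T` is minus the logarithm of this function, which is convex in `lam`. -/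
def centeredPartition (ν : Measure α) (T : α → RVec d) (m lam : RVec d) : ℝ :=
  ∫ x, Real.exp (inner ℝ lam (T x - m)) ∂ν

lemma centeredPartition_change_center (m m' lam : RVec d) :
    centeredPartition ν T m lam
      = Real.exp (inner ℝ lam (m' - m)) * centeredPartition ν T m' lam := by
  rw [centeredPartition, centeredPartition, ← integral_const_mul]
  congr 1
  ext1 x
  rw [← Real.exp_add, ← inner_add_right]
  congr 2
  abel

variable [IsFiniteMeasure ν]

lemma integrable_comp_of_ae_bounded (hT : AEMeasurable T ν) (hB : ∀ᵐ x ∂ν, ‖T x‖ ≤ B)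
    {F : Type*} [NormedAddCommGroup F] {k : RVec d → F} (hk : Continuous k) :
    Integrable (fun x => k (T x)) ν := by
  obtain ⟨b, hb⟩ := (isCompact_closedBall (0 : RVec d) B).exists_bound_of_continuousOn
    hk.continuousOn
  refine ⟨hk.comp_aestronglyMeasurable hT.aestronglyMeasurable,
    HasFiniteIntegral.of_bounded (C := b) ?_⟩
  filter_upwards [hB] with x hx using hb _ (by simpa using hx)

lemma continuous_integral_comp (hT : AEMeasurable T ν) (hB : ∀ᵐ x ∂ν, ‖T x‖ ≤ B) {E : Type*}
    [TopologicalSpace E] [FirstCountableTopology E] [LocallyCompactSpace E]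
    {k : E → RVec d → ℝ} (hk : Continuous (Function.uncurry k)) :
    Continuous fun e => ∫ x, k e (T x) ∂ν := by
  rw [continuous_iff_continuousAt]
  intro e₀
  obtain ⟨s, hs, hs₀⟩ := exists_compact_mem_nhds e₀
  obtain ⟨b, hb⟩ := (hs.prod (isCompact_closedBall (0 : RVec d) B)).exists_bound_of_continuousOn
    hk.continuousOn
  refine continuousAt_of_dominated (bound := fun _ => b) (Eventually.of_forall fun e => ?_) ?_
    (integrable_const b) (Eventually.of_forall fun x => ?_)
  · have : Continuous (k e) := hk.comp (by fun_prop : Continuous fun t => (e, t))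
    exact this.comp_aestronglyMeasurable hT.aestronglyMeasurable
  · filter_upwards [hs₀] with e he
    filter_upwards [hB] with x hx
    exact hb (e, T x) ⟨he, by simpa using hx⟩
  · exact (hk.comp (by fun_prop : Continuous fun e => (e, T x))).continuousAt

lemma integrable_exp_inner (hT : AEMeasurable T ν) (hB : ∀ᵐ x ∂ν, ‖T x‖ ≤ B) (m lam : RVec d) :
    Integrable (fun x => Real.exp (inner ℝ lam (T x - m))) ν :=
  integrable_comp_of_ae_bounded hT hB (k := fun t => Real.exp (inner ℝ lam (t - m))) (by fun_prop)

lemma centeredPartition_pos [NeZero ν] (hT : AEMeasurable T ν) (hB : ∀ᵐ x ∂ν, ‖T x‖ ≤ B)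
    (m lam : RVec d) : 0 < centeredPartition ν T m lam :=
  integral_exp_pos (integrable_exp_inner hT hB m lam)

lemma continuous_centeredPartition (hT : AEMeasurable T ν) (hB : ∀ᵐ x ∂ν, ‖T x‖ ≤ B)
    (m : RVec d) : Continuous (centeredPartition ν T m) :=
  continuous_integral_comp hT hB (k := fun lam t => Real.exp (inner ℝ lam (t - m)))
    (by unfold Function.uncurry; fun_prop)

lemma convexOn_centeredPartition (hT : AEMeasurable T ν) (hB : ∀ᵐ x ∂ν, ‖T x‖ ≤ B)
    (m : RVec d) : ConvexOn ℝ Set.univ (centeredPartition ν T m) := by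
  refine ⟨convex_univ, fun x _ y _ a b ha hb hab => ?_⟩
  simp only [centeredPartition, smul_eq_mul]
  rw [← integral_const_mul, ← integral_const_mul, ← integral_add
    ((integrable_exp_inner hT hB m x).const_mul a) ((integrable_exp_inner hT hB m y).const_mul b)]
  refine integral_mono (integrable_exp_inner hT hB m _)
    (((integrable_exp_inner hT hB m x).const_mul a).add
      ((integrable_exp_inner hT hB m y).const_mul b)) fun u => ?_
  simp only [inner_add_left, real_inner_smul_left]
  simpa using convexOn_exp.2 (Set.mem_univ (inner ℝ x (T u - m)))
    (Set.mem_univ (inner ℝ y (T u - m))) ha hb hab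

lemma one_add_add_sq_le_exp {x : ℝ} (hx : |x| ≤ 1) :
    1 + x + 1 / 4 * x ^ 2 ≤ Real.exp x ∧ Real.exp x ≤ 1 + x + x ^ 2 := by
  constructor
  · have h1 : 0 ≤ 1 + x / 2 := by linarith [(abs_le.1 hx).1]
    have h2 : 1 + x / 2 ≤ Real.exp (x / 2) := by linarith [Real.add_one_le_exp (x / 2)]
    calc 1 + x + 1 / 4 * x ^ 2 = (1 + x / 2) ^ 2 := by ring
      _ ≤ Real.exp (x / 2) ^ 2 := by gcongr
      _ = Real.exp x := by rw [← Real.exp_nat_mul]; congr 1; push_cast; ring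
  · linarith [(abs_le.1 (Real.abs_exp_sub_one_sub_id_le hx)).2]

/-- Second-order expansion of the centered partition function, as inequalities that replace its
derivatives. -/
lemma centeredPartition_add_bounds (hT : AEMeasurable T ν) (hB : ∀ᵐ x ∂ν, ‖T x‖ ≤ B)
    {m t h : RVec d} (hh : ∀ᵐ x ∂ν, |inner ℝ h (T x - m)| ≤ 1) :
    centeredPartition ν T m t + ∫ x, Real.exp (inner ℝ t (T x - m)) * inner ℝ h (T x - m) ∂ν
        + 1 / 4 * ∫ x, Real.exp (inner ℝ t (T x - m)) * inner ℝ h (T x - m) ^ 2 ∂ν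
      ≤ centeredPartition ν T m (t + h) ∧
    centeredPartition ν T m (t + h) ≤
      centeredPartition ν T m t + ∫ x, Real.exp (inner ℝ t (T x - m)) * inner ℝ h (T x - m) ∂ν
        + ∫ x, Real.exp (inner ℝ t (T x - m)) * inner ℝ h (T x - m) ^ 2 ∂ν := by
  have i0 := integrable_exp_inner hT hB m t
  have i1 : Integrable (fun x => Real.exp (inner ℝ t (T x - m)) * inner ℝ h (T x - m)) ν :=
    integrable_comp_of_ae_bounded hT hB
      (k := fun u => Real.exp (inner ℝ t (u - m)) * inner ℝ h (u - m)) (by fun_prop)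
  have i2 : Integrable (fun x => Real.exp (inner ℝ t (T x - m)) * inner ℝ h (T x - m) ^ 2) ν :=
    integrable_comp_of_ae_bounded hT hB
      (k := fun u => Real.exp (inner ℝ t (u - m)) * inner ℝ h (u - m) ^ 2) (by fun_prop)
  have i01 : Integrable (fun x => Real.exp (inner ℝ t (T x - m))
      + Real.exp (inner ℝ t (T x - m)) * inner ℝ h (T x - m)) ν := i0.add i1
  have ih := integrable_exp_inner hT hB m (t + h)
  unfold centeredPartition
  constructor
  · rw [← integral_const_mul, ← integral_add i0 i1, ← integral_add i01 (i2.const_mul _)]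
    refine integral_mono_ae (i01.add (i2.const_mul _)) ih ?_
    filter_upwards [hh] with x hx
    have := mul_le_mul_of_nonneg_left (one_add_add_sq_le_exp hx).1
      (Real.exp_pos (inner ℝ t (T x - m))).le
    rw [inner_add_left, Real.exp_add]
    linarith
  · rw [← integral_add i0 i1, ← integral_add i01 i2]
    refine integral_mono_ae ih (i01.add i2) ?_
    filter_upwards [hh] with x hx
    have := mul_le_mul_of_nonneg_left (one_add_add_sq_le_exp hx).2
      (Real.exp_pos (inner ℝ t (T x - m))).le
    rw [inner_add_left, Real.exp_add]
    linarith

/-- First-order condition at a minimizer: the tilted mean of `T` is `m`. -/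
lemma integral_exp_mul_inner_eq_zero (hT : AEMeasurable T ν) (hB : ∀ᵐ x ∂ν, ‖T x‖ ≤ B)
    {m t : RVec d} (hmin : ∀ lam, centeredPartition ν T m t ≤ centeredPartition ν T m lam)
    (h : RVec d) :
    ∫ x, Real.exp (inner ℝ t (T x - m)) * inner ℝ h (T x - m) ∂ν = 0 := by
  set a := ∫ x, Real.exp (inner ℝ t (T x - m)) * inner ℝ h (T x - m) ∂ν with ha
  set b := ∫ x, Real.exp (inner ℝ t (T x - m)) * inner ℝ h (T x - m) ^ 2 ∂ν with hb
  -- minimality makes the upper expansion `s * a + s ^ 2 * b` along `t + s • h` nonnegative near `0`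
  have hder : HasDerivAt (fun s : ℝ => s * a + s ^ 2 * b) a 0 := by
    have := ((hasDerivAt_id (0 : ℝ)).mul_const a).fun_add ((hasDerivAt_pow 2 (0 : ℝ)).mul_const b)
    exact this.congr_deriv (by simp)
  refine IsLocalMin.hasDerivAt_eq_zero ?_ hder
  have hsmall : ∀ᶠ s : ℝ in 𝓝 0, |s| * (‖h‖ * (B + ‖m‖)) < 1 := by
    have : Continuous fun s : ℝ => |s| * (‖h‖ * (B + ‖m‖)) := by fun_prop
    exact this.continuousAt.eventually_lt continuousAt_const (by simp)
  filter_upwards [hsmall] with s hs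
  have hbound : ∀ᵐ x ∂ν, |inner ℝ (s • h) (T x - m)| ≤ 1 := by
    filter_upwards [hB] with x hx
    calc |inner ℝ (s • h) (T x - m)| ≤ ‖s • h‖ * ‖T x - m‖ := abs_real_inner_le_norm _ _
      _ ≤ (|s| * ‖h‖) * (B + ‖m‖) := by
          rw [norm_smul, Real.norm_eq_abs]
          gcongr
          exact (norm_sub_le _ _).trans (by linarith)
      _ ≤ 1 := by linarith
  have h1 := (centeredPartition_add_bounds (t := t) hT hB hbound).2
  have e1 : ∫ x, Real.exp (inner ℝ t (T x - m)) * inner ℝ (s • h) (T x - m) ∂ν = s * a := by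
    rw [ha, ← integral_const_mul]
    congr 1; ext1 x; rw [real_inner_smul_left]; ring
  have e2 : ∫ x, Real.exp (inner ℝ t (T x - m)) * inner ℝ (s • h) (T x - m) ^ 2 ∂ν
      = s ^ 2 * b := by
    rw [hb, ← integral_const_mul]
    congr 1; ext1 x; rw [real_inner_smul_left]; ring
  rw [e1, e2] at h1
  have h2 := hmin (t + s • h)
  simp only [zero_mul, ne_eq, OfNat.ofNat_ne_zero, not_false_eq_true, zero_pow, add_zero]
  linarith

variable {μ : Measure α}

/-- The second moments of `h' (T - m)` are bounded below, uniformly in `m` near a given point. -/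
lemma exists_le_integral_inner_sq (hT : AEMeasurable T ν) (hB : ∀ᵐ x ∂ν, ‖T x‖ ≤ B)
    (hμν : μ ≪ ν)
    (hfull : ∀ (lam : RVec d) (c : ℝ), (∀ᵐ x ∂μ, inner ℝ lam (T x) = c) → lam = 0)
    (m₀ : RVec d) :
    ∃ κ > 0, ∀ m ∈ Metric.closedBall m₀ 1, ∀ h : RVec d,
      κ * ‖h‖ ^ 2 ≤ ∫ x, inner ℝ h (T x - m) ^ 2 ∂ν := by
  have hc : Continuous fun w : RVec d × RVec d => ∫ x, inner ℝ w.1 (T x - w.2) ^ 2 ∂ν :=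
    continuous_integral_comp hT hB (E := RVec d × RVec d)
      (k := fun (w : RVec d × RVec d) (t : RVec d) => (inner ℝ w.1 (t - w.2) : ℝ) ^ 2)
      (by unfold Function.uncurry; fun_prop)
  have hint : ∀ h m : RVec d, Integrable (fun x => inner ℝ h (T x - m) ^ 2) ν := fun h m =>
    integrable_comp_of_ae_bounded hT hB (k := fun t => inner ℝ h (t - m) ^ 2) (by fun_prop)
  obtain ⟨κ, hκ, hle⟩ := exists_le_neg_of_isCompact
    ((isCompact_sphere (0 : RVec d) 1).prod (isCompact_closedBall m₀ 1))
    (f := fun w => -∫ x, inner ℝ w.1 (T x - w.2) ^ 2 ∂ν) hc.neg.continuousOn (by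
      rintro ⟨v, m⟩ ⟨hv, -⟩
      have h0 : 0 ≤ ∫ x, inner ℝ v (T x - m) ^ 2 ∂ν := integral_nonneg fun x => sq_nonneg _
      refine neg_lt_zero.2 (lt_of_le_of_ne h0 fun he => ?_)
      have h1 := (integral_eq_zero_iff_of_nonneg (fun x => sq_nonneg _) (hint v m)).1 he.symm
      have h2 := hfull v (inner ℝ v m) (by
        filter_upwards [hμν.ae_le h1] with x hx
        have : inner ℝ v (T x - m) = 0 := by simpa using hx
        rw [inner_sub_right] at this
        linarith)
      simp [h2] at hv)
  refine ⟨κ, hκ, fun m hm h => ?_⟩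
  rcases eq_or_ne h 0 with rfl | hne
  · simp
  have hn : ‖h‖ ≠ 0 := norm_ne_zero_iff.2 hne
  have h1 := hle (‖h‖⁻¹ • h, m) ⟨by
    rw [mem_sphere_zero_iff_norm, norm_smul, norm_inv, norm_norm, inv_mul_cancel₀ hn], hm⟩
  have e : ∫ x, inner ℝ h (T x - m) ^ 2 ∂ν
      = ‖h‖ ^ 2 * ∫ x, inner ℝ (‖h‖⁻¹ • h) (T x - m) ^ 2 ∂ν := by
    rw [← integral_const_mul]
    congr 1; ext1 x
    rw [real_inner_smul_left]
    field_simp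
  rw [e, mul_comm]
  gcongr
  simpa using h1

/-- The centered partition function at the true moment attains its minimum. It is coercive, because
`exp u ≥ max u 0` and, the true moment being the mean of `T` under a law dominated by `ν`, no
`v' (T - ∫ T)` is almost everywhere nonpositive. -/
lemma exists_min_centeredPartition [IsProbabilityMeasure μ] (hT : AEMeasurable T ν)
    (hB : ∀ᵐ x ∂ν, ‖T x‖ ≤ B) (hμν : μ ≪ ν)
    (hfull : ∀ (lam : RVec d) (c : ℝ), (∀ᵐ x ∂μ, inner ℝ lam (T x) = c) → lam = 0) :
    ∃ t, ∀ lam, centeredPartition ν T (∫ x, T x ∂μ) t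
      ≤ centeredPartition ν T (∫ x, T x ∂μ) lam := by
  set m := ∫ x, T x ∂μ with hm
  have hTμ : Integrable T μ :=
    integrable_comp_of_ae_bounded (k := fun t => t) (hT.mono_ac hμν) (hμν.ae_le hB) continuous_id
  have hc : Continuous fun v : RVec d => ∫ x, max (inner ℝ v (T x - m)) 0 ∂ν :=
    continuous_integral_comp hT hB (k := fun v t => max (inner ℝ v (t - m)) 0)
      (by unfold Function.uncurry; fun_prop)
  have hint : ∀ v : RVec d, Integrable (fun x => max (inner ℝ v (T x - m)) 0) ν := fun v =>
    integrable_comp_of_ae_bounded hT hB (k := fun t => max (inner ℝ v (t - m)) 0) (by fun_prop)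
  obtain ⟨c, hc0, hle⟩ := exists_le_neg_of_isCompact (isCompact_sphere (0 : RVec d) 1)
    (f := fun v => -∫ x, max (inner ℝ v (T x - m)) 0 ∂ν) hc.neg.continuousOn (by
      intro v hv
      have h0 : 0 ≤ ∫ x, max (inner ℝ v (T x - m)) 0 ∂ν :=
        integral_nonneg fun x => le_max_right _ _
      refine neg_lt_zero.2 (lt_of_le_of_ne h0 fun he => ?_)
      have h1 := (integral_eq_zero_iff_of_nonneg (fun x => le_max_right _ _) (hint v)).1 he.symm
      have h2 : ∀ᵐ x ∂μ, 0 ≤ -inner ℝ v (T x - m) := by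
        filter_upwards [hμν.ae_le h1] with x hx
        have hx' : max (inner ℝ v (T x - m)) 0 = 0 := hx
        linarith [le_max_left (inner ℝ v (T x - m)) 0]
      have hTm : Integrable (fun x => T x - m) μ := hTμ.sub (integrable_const m)
      have h3 : ∫ x, -inner ℝ v (T x - m) ∂μ = 0 := by
        rw [integral_neg, integral_inner hTm, integral_sub hTμ (integrable_const m)]
        simp [hm]
      have h4 := (integral_eq_zero_iff_of_nonneg_ae h2 (hTm.const_inner v).neg).1 h3
      have h5 := hfull v (inner ℝ v m) (by
        filter_upwards [h4] with x hx
        have : -inner ℝ v (T x - m) = 0 := hx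
        rw [inner_sub_right] at this
        linarith)
      simp [h5] at hv)
  refine (continuous_centeredPartition hT hB m).exists_forall_le ?_
  refine tendsto_atTop_mono (f := fun lam : RVec d => c * ‖lam‖) (fun lam => ?_)
    ((tendsto_norm_cocompact_atTop (E := RVec d)).const_mul_atTop hc0)
  have hexp : ∫ x, max (inner ℝ lam (T x - m)) 0 ∂ν ≤ centeredPartition ν T m lam :=
    integral_mono (hint lam) (integrable_exp_inner hT hB m lam) fun x =>
      max_le (by linarith [Real.add_one_le_exp (inner ℝ lam (T x - m))]) (Real.exp_pos _).le
  refine le_trans ?_ hexp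
  rcases eq_or_ne lam 0 with rfl | hne
  · simp
  have hn : ‖lam‖ ≠ 0 := norm_ne_zero_iff.2 hne
  have h1 := hle (‖lam‖⁻¹ • lam) (by
    rw [mem_sphere_zero_iff_norm, norm_smul, norm_inv, norm_norm, inv_mul_cancel₀ hn])
  have e : ∫ x, max (inner ℝ lam (T x - m)) 0 ∂ν
      = ‖lam‖ * ∫ x, max (inner ℝ (‖lam‖⁻¹ • lam) (T x - m)) 0 ∂ν := by
    rw [← integral_const_mul]
    congr 1; ext1 x
    rw [real_inner_smul_left, mul_max_of_nonneg _ _ (norm_nonneg lam), mul_zero,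
      mul_inv_cancel_left₀ hn]
  rw [e, mul_comm]
  gcongr
  simpa using h1

/-- Near a point `θ₀`, the logarithm of the centered partition function grows quadratically around
its minimizers, and the minimum is separated, with constants that are uniform for `m` near the true
moment. -/
theorem exists_centeredPartition_gap [IsProbabilityMeasure μ] [NeZero ν] (hT : AEMeasurable T ν)
    (hB : ∀ᵐ x ∂ν, ‖T x‖ ≤ B) (hμν : μ ≪ ν)
    (hfull : ∀ (lam : RVec d) (c : ℝ), (∀ᵐ x ∂μ, inner ℝ lam (T x) = c) → lam = 0) :
    ∃ (θ₀ : RVec d) (ρ c C δ η : ℝ), 0 < ρ ∧ 0 < c ∧ 0 < C ∧ 0 < δ ∧ 0 < η ∧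
      ∀ m : RVec d, dist m (∫ x, T x ∂μ) ≤ η →
        (∀ θ, ρ ≤ dist θ θ₀ → -Real.log (centeredPartition ν T m θ)
          ≤ -Real.log (centeredPartition ν T m θ₀) - δ) ∧
        ∀ t ∈ Metric.ball θ₀ ρ,
          (∀ lam, centeredPartition ν T m t ≤ centeredPartition ν T m lam) →
          ∀ θ ∈ Metric.closedBall θ₀ (2 * ρ),
            c * ‖θ - t‖ ^ 2 ≤ Real.log (centeredPartition ν T m θ)
              - Real.log (centeredPartition ν T m t) ∧
            Real.log (centeredPartition ν T m θ) - Real.log (centeredPartition ν T m t)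
              ≤ C * ‖θ - t‖ ^ 2 := by
  set m₀ := ∫ x, T x ∂μ with hm₀
  obtain ⟨θ₀, hθ₀⟩ := exists_min_centeredPartition hT hB hμν hfull
  rw [← hm₀] at hθ₀
  obtain ⟨κ, hκ, hvar⟩ := exists_le_integral_inner_sq hT hB hμν hfull m₀
  set D : ℝ := |B| + ‖m₀‖ + 1 with hD
  have hD1 : 1 ≤ D := by
    have := abs_nonneg B
    have := norm_nonneg m₀
    linarith
  have hD0 : 0 < D := by linarith
  have hTm : ∀ m ∈ Metric.closedBall m₀ 1, ∀ᵐ x ∂ν, ‖T x - m‖ ≤ D := by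
    intro m hm
    filter_upwards [hB] with x hx
    have h1 : ‖m‖ ≤ ‖m₀‖ + 1 := by
      have := norm_sub_norm_le m m₀
      rw [Metric.mem_closedBall, dist_eq_norm] at hm
      linarith
    linarith [norm_sub_le (T x) m, le_abs_self B]
  -- two points of the balls in question are less than `3 * ρ` apart, so that `|h' (T - m)| ≤ 1`
  set ρ : ℝ := 1 / (3 * D) with hρ
  have hρ0 : 0 < ρ := by positivity
  -- `R` bounds the exponent `t' (T - m)`, hence the tilting weights from both sides
  set R : ℝ := (‖θ₀‖ + ρ) * D with hR
  set V : ℝ := ν.real Set.univ with hV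
  have hV0 : 0 < V := by
    rw [hV, Measure.real, ENNReal.toReal_pos_iff]
    exact ⟨(NeZero.ne (ν Set.univ)).bot_lt, measure_lt_top _ _⟩
  set a : ℝ := 1 / 4 * (Real.exp (-R) * κ) / (Real.exp R * V) with ha
  have ha0 : 0 < a := by positivity
  have hcurv : ∀ m ∈ Metric.closedBall m₀ 1, ∀ t ∈ Metric.ball θ₀ ρ,
      (∀ lam, centeredPartition ν T m t ≤ centeredPartition ν T m lam) →
      ∀ θ ∈ Metric.closedBall θ₀ (2 * ρ),
        a / 2 * ‖θ - t‖ ^ 2 ≤ Real.log (centeredPartition ν T m θ)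
            - Real.log (centeredPartition ν T m t) ∧
          Real.log (centeredPartition ν T m θ) - Real.log (centeredPartition ν T m t)
            ≤ D ^ 2 * ‖θ - t‖ ^ 2 := by
    intro m hm t ht hmin θ hθ
    have hbd := hTm m hm
    set h : RVec d := θ - t with hh
    have hth : t + h = θ := by rw [hh]; abel
    have hnh : ‖h‖ * D ≤ 1 := by
      have h1 : dist θ t ≤ dist θ θ₀ + dist t θ₀ := dist_triangle_right _ _ _
      rw [Metric.mem_closedBall] at hθ
      rw [Metric.mem_ball] at ht
      have h2 : ‖h‖ ≤ 3 * ρ := by rw [hh, ← dist_eq_norm]; linarith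
      calc ‖h‖ * D ≤ 3 * ρ * D := by gcongr
        _ = 1 := by rw [hρ]; field_simp
    have hinner : ∀ᵐ x ∂ν, |inner ℝ h (T x - m)| ≤ ‖h‖ * D := by
      filter_upwards [hbd] with x hx
      exact (abs_real_inner_le_norm _ _).trans (by gcongr)
    obtain ⟨hlo, hhi⟩ := centeredPartition_add_bounds (t := t) hT hB (m := m) (h := h)
      (hinner.mono fun x hx => hx.trans hnh)
    rw [integral_exp_mul_inner_eq_zero hT hB hmin h, add_zero, hth] at hlo hhi
    have hw : ∀ᵐ x ∂ν, |inner ℝ t (T x - m)| ≤ R := by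
      filter_upwards [hbd] with x hx
      have h1 : ‖t‖ ≤ ‖θ₀‖ + ρ := by
        have := norm_sub_norm_le t θ₀
        rw [Metric.mem_ball, dist_eq_norm] at ht
        linarith
      exact (abs_real_inner_le_norm _ _).trans (by rw [hR]; gcongr)
    have i0 := integrable_exp_inner hT hB m t
    have i2 : Integrable (fun x => Real.exp (inner ℝ t (T x - m)) * inner ℝ h (T x - m) ^ 2) ν :=
      integrable_comp_of_ae_bounded hT hB
        (k := fun u => Real.exp (inner ℝ t (u - m)) * inner ℝ h (u - m) ^ 2) (by fun_prop)
    have j2 : Integrable (fun x => inner ℝ h (T x - m) ^ 2) ν :=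
      integrable_comp_of_ae_bounded hT hB (k := fun u => inner ℝ h (u - m) ^ 2) (by fun_prop)
    have hψ := centeredPartition_pos hT hB m t
    have hψθ := centeredPartition_pos hT hB m θ
    have hψle : centeredPartition ν T m t ≤ Real.exp R * V := by
      calc centeredPartition ν T m t ≤ ∫ _, Real.exp R ∂ν :=
            integral_mono_ae i0 (integrable_const _) (hw.mono fun x hx =>
              Real.exp_le_exp.2 (abs_le.1 hx).2)
        _ = Real.exp R * V := by rw [integral_const, smul_eq_mul, mul_comm]
    have hq_lo : Real.exp (-R) * (κ * ‖h‖ ^ 2)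
        ≤ ∫ x, Real.exp (inner ℝ t (T x - m)) * inner ℝ h (T x - m) ^ 2 ∂ν := by
      calc Real.exp (-R) * (κ * ‖h‖ ^ 2)
          ≤ Real.exp (-R) * ∫ x, inner ℝ h (T x - m) ^ 2 ∂ν := by gcongr; exact hvar m hm h
        _ = ∫ x, Real.exp (-R) * inner ℝ h (T x - m) ^ 2 ∂ν := (integral_const_mul _ _).symm
        _ ≤ _ := integral_mono_ae (j2.const_mul _) i2 (hw.mono fun x hx => by
            have := (abs_le.1 hx).1
            dsimp only
            gcongr)
    have hq_hi : ∫ x, Real.exp (inner ℝ t (T x - m)) * inner ℝ h (T x - m) ^ 2 ∂ν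
        ≤ (D ^ 2 * ‖h‖ ^ 2) * centeredPartition ν T m t := by
      rw [centeredPartition, ← integral_const_mul]
      refine integral_mono_ae i2 (i0.const_mul _) (hinner.mono fun x hx => ?_)
      have : inner ℝ h (T x - m) ^ 2 ≤ (‖h‖ * D) ^ 2 := sq_le_sq' (abs_le.1 hx).1 (abs_le.1 hx).2
      dsimp only
      rw [mul_comm]
      gcongr
      linarith
    set x : ℝ := a * ‖h‖ ^ 2 with hx
    have hx0 : 0 ≤ x := by positivity
    have hxle : x * centeredPartition ν T m t
        ≤ 1 / 4 * ∫ x, Real.exp (inner ℝ t (T x - m)) * inner ℝ h (T x - m) ^ 2 ∂ν := by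
      calc x * centeredPartition ν T m t ≤ x * (Real.exp R * V) := by gcongr
        _ = 1 / 4 * (Real.exp (-R) * (κ * ‖h‖ ^ 2)) := by
            rw [hx, ha]; field_simp
        _ ≤ _ := by gcongr
    have hx1 : x ≤ 1 := by
      have h1 : D ^ 2 * ‖h‖ ^ 2 ≤ 1 := by
        calc D ^ 2 * ‖h‖ ^ 2 = (‖h‖ * D) ^ 2 := by ring
          _ ≤ 1 := pow_le_one₀ (by positivity) hnh
      have h2 : x * centeredPartition ν T m t ≤ 1 / 4 * (1 * centeredPartition ν T m t) :=
        hxle.trans (by gcongr; exact hq_hi.trans (by gcongr))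
      nlinarith
    constructor
    · rw [← Real.log_div hψθ.ne' hψ.ne']
      have h1 : 1 + x ≤ centeredPartition ν T m θ / centeredPartition ν T m t := by
        rw [le_div_iff₀ hψ]; linarith
      have h2 := Real.log_le_log (by positivity) h1
      have h3 := Real.one_sub_inv_le_log_of_pos (show 0 < 1 + x by positivity)
      have h4 : x / 2 ≤ 1 - (1 + x)⁻¹ := by
        rw [div_le_iff₀ two_pos]
        field_simp
        nlinarith
      calc a / 2 * ‖h‖ ^ 2 = x / 2 := by rw [hx]; ring
        _ ≤ _ := by linarith
    · rw [← Real.log_div hψθ.ne' hψ.ne']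
      have h1 : centeredPartition ν T m θ / centeredPartition ν T m t ≤ 1 + D ^ 2 * ‖h‖ ^ 2 := by
        rw [div_le_iff₀ hψ]; linarith
      have h2 := Real.log_le_sub_one_of_pos (show 0 < centeredPartition ν T m θ
        / centeredPartition ν T m t by positivity)
      linarith
  set δ : ℝ := a / 2 * ρ ^ 2 / 2 with hδ
  have hδ0 : 0 < δ := by positivity
  refine ⟨θ₀, ρ, a / 2, D ^ 2, δ, min 1 (δ / ρ), hρ0, by positivity, by positivity, hδ0,
    lt_min one_pos (by positivity), fun m hm => ?_⟩
  have hm1 : m ∈ Metric.closedBall m₀ 1 := hm.trans (min_le_left _ _)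
  refine ⟨?_, fun t ht hmin θ hθ => hcurv m hm1 t ht hmin θ hθ⟩
  have hψ := fun lam => centeredPartition_pos hT hB m lam
  -- on the sphere the gap at the true moment dominates the change of the moment
  have hsphere : ∀ θ ∈ Metric.sphere θ₀ ρ,
      Real.log (centeredPartition ν T m θ₀) + δ ≤ Real.log (centeredPartition ν T m θ) := by
    intro θ hθ
    have hθn : ‖θ - θ₀‖ = ρ := by rwa [mem_sphere_iff_norm] at hθ
    have h1 := (hcurv m₀ (Metric.mem_closedBall_self zero_le_one) θ₀ (Metric.mem_ball_self hρ0)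
      hθ₀ θ (Metric.sphere_subset_closedBall.trans
        (Metric.closedBall_subset_closedBall (by linarith)) hθ)).1
    rw [hθn] at h1
    have e : ∀ lam, Real.log (centeredPartition ν T m lam)
        = inner ℝ lam (m₀ - m) + Real.log (centeredPartition ν T m₀ lam) := fun lam => by
      rw [centeredPartition_change_center m m₀ lam,
        Real.log_mul (Real.exp_pos _).ne' (centeredPartition_pos hT hB m₀ lam).ne', Real.log_exp]
    have h2 : |inner ℝ (θ - θ₀) (m₀ - m)| ≤ δ := by
      calc |inner ℝ (θ - θ₀) (m₀ - m)| ≤ ‖θ - θ₀‖ * ‖m₀ - m‖ := abs_real_inner_le_norm _ _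
        _ ≤ ρ * (δ / ρ) := by
            rw [hθn, ← dist_eq_norm, dist_comm]
            gcongr
            exact hm.trans (min_le_right _ _)
        _ = δ := by field_simp
    have h3 := (abs_le.1 h2).1
    rw [inner_sub_left] at h3
    rw [e, e]
    linarith
  intro θ hθ
  -- convexity extends the gap beyond the sphere
  have h1 := concave_gap_outside_ball (convexOn_centeredPartition hT hB m).neg (Set.mem_univ θ₀)
    hρ0 (δ := (Real.exp δ - 1) * centeredPartition ν T m θ₀)
    (mul_nonneg (by linarith [Real.add_one_le_exp δ]) (hψ θ₀).le) (fun θ hθ => by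
      have h2 := Real.exp_le_exp.2 (hsphere θ hθ)
      rw [Real.exp_add, Real.exp_log (hψ _), Real.exp_log (hψ _)] at h2
      simp only [Pi.neg_apply]
      linarith) θ (Set.mem_univ θ) hθ
  simp only [Pi.neg_apply] at h1
  have h2 : centeredPartition ν T m θ₀ * Real.exp δ ≤ centeredPartition ν T m θ := by linarith
  have h3 := Real.log_le_log (mul_pos (hψ _) (Real.exp_pos _)) h2
  rw [Real.log_mul (hψ _).ne' (Real.exp_pos _).ne', Real.log_exp] at h3
  linarith

end Partition

/-! ### Exponential families and optimum information estimators -/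

section ExpFamily

lemma mul_log_sub_ge {h g : ℝ} (hh : 0 ≤ h) (hg : 0 < g) :
    h * Real.log g + (h - g) ≤ h * Real.log h := by
  rcases hh.eq_or_lt with rfl | hh
  · simpa using hg.le
  have h1 := mul_le_mul_of_nonneg_left (Real.log_le_sub_one_of_pos (div_pos hg hh)) hh.le
  rw [Real.log_div hg.ne' hh.ne'] at h1
  have h2 : h * (g / h - 1) = g - h := by field_simp
  linarith

lemma neZero_of_absolutelyContinuous {α : Type*} [MeasurableSpace α] {μ ν : Measure α}
    [IsProbabilityMeasure μ] (h : μ ≪ ν) :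
    NeZero ν := by
  refine ⟨fun h0 => IsProbabilityMeasure.ne_zero μ ?_⟩
  rw [h0] at h
  exact Measure.absolutelyContinuous_zero_iff.1 h

variable {α : Type*} [MeasureSpace α]

lemma ExpFamily.density_eq (F : ExpFamily α) {x : α} (hx : x ∈ F.S) (lam : RVec F.dim) :
    F.density x lam = Real.exp (inner ℝ lam (F.T x))
      / centeredPartition (volume.restrict F.S) F.T 0 lam := by
  simp [ExpFamily.density, hx, centeredPartition]

variable [TopologicalSpace α] {F : ExpFamily α} {μ : Measure α}

lemma ExpFamily.IsRegular.isFiniteMeasure [IsFiniteMeasureOnCompacts (volume : Measure α)]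
    (hF : F.IsRegular μ) : IsFiniteMeasure (volume.restrict F.S) :=
  isFiniteMeasure_restrict.2 hF.compact.measure_lt_top.ne

variable [T2Space α] [OpensMeasurableSpace α]

lemma ExpFamily.IsRegular.measurableSet (hF : F.IsRegular μ) : MeasurableSet F.S :=
  hF.compact.isClosed.measurableSet

lemma ExpFamily.IsRegular.exists_ae_bound (hF : F.IsRegular μ) :
    ∃ B : ℝ, ∀ᵐ x ∂(volume.restrict F.S), ‖F.T x‖ ≤ B := by
  obtain ⟨B, hB⟩ := hF.bounded
  exact ⟨B, (ae_restrict_mem hF.measurableSet).mono hB⟩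

variable [IsFiniteMeasureOnCompacts (volume : Measure α)]

lemma ExpFamily.IsRegular.density_pos [IsProbabilityMeasure μ] (hF : F.IsRegular μ)
    (hμ : μ ≪ volume.restrict F.S) {x : α} (hx : x ∈ F.S) (lam : RVec F.dim) :
    0 < F.density x lam := by
  have := hF.isFiniteMeasure
  have := neZero_of_absolutelyContinuous hμ
  obtain ⟨B, hB⟩ := hF.exists_ae_bound
  rw [F.density_eq hx]
  exact div_pos (Real.exp_pos _) (centeredPartition_pos hF.measurable hB 0 lam)

lemma ExpFamily.IsRegular.continuous_density [IsProbabilityMeasure μ] (hF : F.IsRegular μ)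
    (hμ : μ ≪ volume.restrict F.S) {x : α} (hx : x ∈ F.S) : Continuous (F.density x) := by
  have := hF.isFiniteMeasure
  have := neZero_of_absolutelyContinuous hμ
  obtain ⟨B, hB⟩ := hF.exists_ae_bound
  rw [funext fun lam => F.density_eq hx lam]
  exact Continuous.div (by fun_prop) (continuous_centeredPartition hF.measurable hB 0)
    fun lam => (centeredPartition_pos hF.measurable hB 0 lam).ne'

lemma ExpFamily.IsRegular.meanLogLik_eq [IsProbabilityMeasure μ] (hF : F.IsRegular μ)
    (hμ : μ ≪ volume.restrict F.S) {z : ℕ → α} (hz : ∀ n, z n ∈ F.S) {N : ℕ} (hN : 1 ≤ N)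
    (lam : RVec F.dim) :
    meanLogLik F.density z N lam
      = -Real.log (centeredPartition (volume.restrict F.S) F.T (sampleMoment F.T z N) lam) := by
  have := hF.isFiniteMeasure
  have := neZero_of_absolutelyContinuous hμ
  obtain ⟨B, hB⟩ := hF.exists_ae_bound
  have hN0 : (N : ℝ) ≠ 0 := by positivity
  have hpos := centeredPartition_pos hF.measurable hB 0 lam
  rw [centeredPartition_change_center _ 0 lam,
    Real.log_mul (Real.exp_pos _).ne' hpos.ne', Real.log_exp, meanLogLik,
    Finset.sum_congr rfl fun n _ => by
      rw [F.density_eq (hz n), Real.log_div (Real.exp_pos _).ne' hpos.ne', Real.log_exp],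
    Finset.sum_sub_distrib, Finset.sum_const, Finset.card_range, nsmul_eq_mul, zero_sub,
    inner_neg_right, sampleMoment, real_inner_smul_right, inner_sum]
  field_simp
  ring

/-- The member of an exponential family that satisfies the first-order condition for the moment `m`
minimizes `∫ g log g` among the densities of moment `m`: its logarithm is affine in `T`, so that
`∫ h log g` is the same for all these densities `h`, and `h log h - h log g ≥ h - g`. -/
lemma ExpFamily.IsRegular.isOIE_of_isMin [IsProbabilityMeasure μ] (hF : F.IsRegular μ)
    (hμ : μ ≪ volume.restrict F.S) {m t : RVec F.dim}
    (hmin : ∀ lam, centeredPartition (volume.restrict F.S) F.T m t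
      ≤ centeredPartition (volume.restrict F.S) F.T m lam) :
    IsOIE F.S F.T m (fun x => F.density x t) := by
  have := hF.isFiniteMeasure
  have := neZero_of_absolutelyContinuous hμ
  obtain ⟨B, hB⟩ := hF.exists_ae_bound
  have hSm := hF.measurableSet
  set ν := (volume.restrict F.S : Measure α) with hν
  set A := centeredPartition ν F.T 0 t with hA
  have hApos : 0 < A := centeredPartition_pos hF.measurable hB 0 t
  have hg : ∀ᵐ x ∂ν, F.density x t = Real.exp (inner ℝ t (F.T x)) / A :=
    (ae_restrict_mem hSm).mono fun x hx => F.density_eq hx t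
  have hgpos : ∀ᵐ x ∂ν, 0 < F.density x t :=
    (ae_restrict_mem hSm).mono fun x hx => hF.density_pos hμ hx t
  have hlogg : ∀ᵐ x ∂ν, Real.log (F.density x t) = inner ℝ t (F.T x) - Real.log A := by
    filter_upwards [hg] with x hx
    rw [hx, Real.log_div (Real.exp_pos _).ne' hApos.ne', Real.log_exp]
  have hgint : Integrable (fun x => F.density x t) ν :=
    (integrable_congr hg).2 (integrable_comp_of_ae_bounded hF.measurable hB
      (k := fun u => Real.exp (inner ℝ t u) / A) (by fun_prop))
  have hgT : Integrable (fun x => F.density x t • F.T x) ν := by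
    refine (integrable_congr (hg.mono fun x hx => ?_)).2
      (integrable_comp_of_ae_bounded hF.measurable hB
        (k := fun u => (Real.exp (inner ℝ t u) / A) • u) (by fun_prop))
    simp only [hx]
  have hgone : ∫ x, F.density x t ∂ν = 1 := by
    rw [integral_congr_ae hg, integral_div, div_eq_one_iff_eq hApos.ne', hA, centeredPartition]
    simp
  have hgmom : ∫ x, F.density x t • F.T x ∂ν = m := by
    have hgm : Integrable (fun x => F.density x t • m) ν := hgint.smul_const m
    have h0 : ∫ x, (F.density x t • F.T x - F.density x t • m) ∂ν = 0 := by
      refine ext_inner_left ℝ fun h => ?_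
      have hsub : Integrable (fun x => F.density x t • F.T x - F.density x t • m) ν := hgT.sub hgm
      rw [← integral_inner hsub, inner_zero_right]
      have h1 := integral_exp_mul_inner_eq_zero hF.measurable hB hmin h
      rw [← mul_zero (Real.exp (inner ℝ t m) / A), ← h1, ← integral_const_mul]
      refine integral_congr_ae (hg.mono fun x hx => ?_)
      have e : Real.exp (inner ℝ t (F.T x))
          = Real.exp (inner ℝ t m) * Real.exp (inner ℝ t (F.T x - m)) := by
        rw [← Real.exp_add, ← inner_add_right]; congr 2; abel
      simp only [hx]
      rw [← smul_sub, real_inner_smul_right, e]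
      ring
    rw [integral_sub hgT hgm, integral_smul_const, hgone, one_smul, sub_eq_zero] at h0
    exact h0
  -- the cross entropy is the same for all densities of moment `m`
  have hcross : ∀ h : α → ℝ, MomentAdmissible F.S F.T m h →
      Integrable (fun x => h x * Real.log (F.density x t)) ν ∧
      ∫ x, h x * Real.log (F.density x t) ∂ν = inner ℝ t m - Real.log A := by
    rintro h ⟨hint, -, hone, hTint, hmom⟩
    have e : ∀ᵐ x ∂ν, h x * Real.log (F.density x t)
        = inner ℝ t (h x • F.T x) - h x * Real.log A := by
      filter_upwards [hlogg] with x hx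
      rw [hx, real_inner_smul_right]; ring
    have i1 : Integrable (fun x => inner ℝ t (h x • F.T x)) ν := hTint.const_inner t
    have i2 : Integrable (fun x => h x * Real.log A) ν := hint.mul_const _
    refine ⟨(integrable_congr e).2 (i1.sub i2), ?_⟩
    rw [integral_congr_ae e, integral_sub i1 i2, integral_inner hTint, integral_mul_const, hmom,
      hone, one_mul]
  have hadm : MomentAdmissible F.S F.T m (fun x => F.density x t) :=
    ⟨hgint, hgpos.mono fun x hx => hx.le, hgone, hgT, hgmom⟩
  refine ⟨hadm, (hcross _ hadm).1, fun h hh hlog => ?_⟩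
  rw [(hcross _ hadm).2, ← (hcross h hh).2]
  have i3 : Integrable (fun x => h x - F.density x t) ν := hh.1.sub hgint
  have h1 : ∫ x, (h x - F.density x t) ∂ν = 0 := by
    rw [integral_sub hh.1 hgint, hgone, hh.2.2.1, sub_self]
  calc ∫ x, h x * Real.log (F.density x t) ∂ν
      = ∫ x, (h x * Real.log (F.density x t) + (h x - F.density x t)) ∂ν := by
        rw [integral_add (hcross h hh).1 i3, h1, add_zero]
    _ ≤ ∫ x, h x * Real.log (h x) ∂ν := by
        refine integral_mono_ae ((hcross h hh).1.add i3) hlog ?_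
        filter_upwards [hh.2.1, hgpos] with x hx hgx using mul_log_sub_ge hx hgx

/-- For a regular exponential family, the evidence almost surely approximates the Bayesian
likelihood up to a deterministic error, and maximum likelihood estimates give optimum information
estimators. The pseudo-true parameter, a minimizer of the centered partition function, exists
although the true density need not belong to the family. -/
theorem ExpFamily.IsRegular.exists_evidenceApprox {Ω : Type*} [MeasurableSpace Ω] {P : Measure Ω}
    [IsProbabilityMeasure μ] (hF : F.IsRegular μ) (hμ : μ ≪ volume.restrict F.S)
    {Z : ℕ → Ω → α} (hZ : ∀ n, Measurable (Z n))
    (hind : Pairwise fun i j => IndepFun (Z i) (Z j) P) (hlaw : ∀ n, P.map (Z n) = μ) :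
    ∃ K : ℝ, ∀ᵐ ω ∂P, ∀ᶠ N : ℕ in atTop,
      EvidenceApprox F.density Set.univ F.prior K (fun n => Z n ω) N ∧
      ∀ t, IsMLE F.density Set.univ (fun n => Z n ω) N t →
        IsOIE F.S F.T (sampleMoment F.T (fun n => Z n ω) N) (fun x => F.density x t) := by
  have := hF.isFiniteMeasure
  have := neZero_of_absolutelyContinuous hμ
  obtain ⟨B, hB⟩ := hF.exists_ae_bound
  obtain ⟨θ₀, ρ, c, C, δ, η, hρ, hc, hC, hδ, hη, hgap⟩ :=
    exists_centeredPartition_gap hF.measurable hB hμ hF.full_dim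
  obtain ⟨K, hK⟩ := OptInfo.exists_evidenceApprox (α := α) (g := F.density) MeasurableSet.univ
    hF.prior (θ₀ := θ₀) hc hC.le hδ hρ (by simp)
  have hμS : ∀ᵐ x ∂μ, x ∈ F.S := hμ.ae_le (ae_restrict_mem hF.measurableSet)
  -- `T` is only almost everywhere measurable: the strong law is applied to a measurable version
  have hTμ : ∀ᵐ x ∂μ, F.T x = hF.measurable.mk F.T x := hμ.ae_le hF.measurable.ae_eq_mk
  have hpull : ∀ p : α → Prop, (∀ᵐ x ∂μ, p x) → ∀ᵐ ω ∂P, ∀ n, p (Z n ω) := by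
    intro p hp
    rw [ae_all_iff]
    intro n
    refine ae_of_ae_map (hZ n).aemeasurable ?_
    rwa [hlaw n]
  have hTi : Integrable (hF.measurable.mk F.T) μ :=
    (integrable_congr hTμ).1 (integrable_comp_of_ae_bounded (k := fun t => t)
      (hF.measurable.mono_ac hμ) (hμ.ae_le hB) continuous_id)
  refine ⟨K, ?_⟩
  filter_upwards [hpull _ hμS, hpull _ hTμ,
    strong_law_comp hZ hind hlaw hF.measurable.measurable_mk hTi] with ω hωS hωT hω
  have hmom : Tendsto (fun N => sampleMoment F.T (fun n => Z n ω) N) atTop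
      (𝓝 (∫ x, F.T x ∂μ)) := by
    rw [integral_congr_ae hTμ]
    refine hω.congr fun N => ?_
    rw [sampleMoment, Finset.sum_congr rfl fun n _ => hωT n]
  filter_upwards [Metric.tendsto_nhds.1 hmom η hη, eventually_ge_atTop 1] with N hNη hN
  obtain ⟨hfar, hcurv⟩ := hgap _ hNη.le
  have hmll := hF.meanLogLik_eq hμ hωS hN
  have hpos : ∀ n, ∀ θ ∈ (Set.univ : Set (RVec F.dim)), 0 < F.density (Z n ω) θ :=
    fun n θ _ => hF.density_pos hμ (hωS n) θ
  have hmin : ∀ t, IsMaxOn (meanLogLik F.density (fun n => Z n ω) N) Set.univ t →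
      ∀ lam, centeredPartition (volume.restrict F.S) F.T (sampleMoment F.T (fun n => Z n ω) N) t
        ≤ centeredPartition (volume.restrict F.S) F.T
          (sampleMoment F.T (fun n => Z n ω) N) lam := by
    intro t ht lam
    have h1 := isMaxOn_iff.1 ht lam (Set.mem_univ _)
    rw [hmll, hmll, neg_le_neg_iff] at h1
    exact (Real.log_le_log_iff (centeredPartition_pos hF.measurable hB _ _)
      (centeredPartition_pos hF.measurable hB _ _)).1 h1
  refine ⟨hK _ N hpos (fun n => (hF.continuous_density hμ (hωS n)).continuousOn) hN ?_ ?_, ?_⟩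
  · intro θ _ h
    rw [hmll, hmll]
    exact hfar θ h
  · intro t ht hmax θ hθ
    rw [hmll, hmll]
    obtain ⟨h1, h2⟩ := hcurv t ht (hmin t hmax) θ hθ
    constructor <;> linarith
  · intro t ht
    exact hF.isOIE_of_isMin hμ (hmin t ((isMaxOn_likelihood_iff hpos hN ht.1).1 ht.2))

end ExpFamily

/-! ### Posterior probabilities -/

section Posterior

variable {ι : Type*} [Fintype ι]

lemma posterior_const_mul {w c : ℝ} (hw : w ≠ 0) (hc : c ≠ 0) (ℓ : ι → ℝ) (m : ι) :
    posterior (fun _ => w) (fun k => ℓ k * c) m = ℓ m / ∑ k, ℓ k := by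
  rw [posterior]
  have e : ∑ k, w * (ℓ k * c) = w * c * ∑ k, ℓ k := by
    rw [Finset.mul_sum]; exact Finset.sum_congr rfl fun k _ => by ring
  rw [e, show w * (ℓ m * c) = w * c * ℓ m by ring, mul_div_mul_left _ _ (mul_ne_zero hw hc)]

lemma sum_exp_pos [Nonempty ι] (E : ι → ℝ) : 0 < ∑ k, Real.exp (E k) :=
  Finset.sum_pos (fun _ _ => Real.exp_pos _) Finset.univ_nonempty

lemma expWeights_nonneg (E : ι → ℝ) (m : ι) : 0 ≤ expWeights E m :=
  div_nonneg (Real.exp_pos _).le (Finset.sum_nonneg fun _ _ => (Real.exp_pos _).le)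

lemma sum_expWeights [Nonempty ι] (E : ι → ℝ) : ∑ m, expWeights E m = 1 := by
  simp only [expWeights]
  rw [← Finset.sum_div, div_self (sum_exp_pos E).ne']

lemma expWeights_le_exp_sub (E : ι → ℝ) (m k : ι) :
    expWeights E k ≤ Real.exp (-(E m - E k)) := by
  have : Nonempty ι := ⟨m⟩
  rw [expWeights, div_le_iff₀ (sum_exp_pos E)]
  calc Real.exp (E k) = Real.exp (-(E m - E k)) * Real.exp (E m) := by
        rw [← Real.exp_add]; congr 1; ring
    _ ≤ _ := by
        gcongr
        exact Finset.single_le_sum (f := fun k => Real.exp (E k)) (fun _ _ => (Real.exp_pos _).le)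
          (Finset.mem_univ m)

/-- Errors of at most `K` in the exponents change normalized weights by a factor of at most
`exp (2 * K)`, one `exp K` each for the numerator and the denominator. -/
lemma expWeights_bounds {b E : ι → ℝ} {K : ℝ} (hb : ∀ k, 0 < b k)
    (hE : ∀ k, |Real.log (b k) - E k| ≤ K) (m : ι) :
    (Real.exp (2 * K))⁻¹ * expWeights E m ≤ b m / ∑ k, b k ∧
      b m / ∑ k, b k ≤ Real.exp (2 * K) * expWeights E m := by
  have : Nonempty ι := ⟨m⟩
  have hS : 0 < ∑ k, b k := Finset.sum_pos (fun k _ => hb k) Finset.univ_nonempty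
  have hSE := sum_exp_pos E
  have hle : ∀ k, b k ≤ Real.exp K * Real.exp (E k) := fun k => by
    rw [← Real.exp_add, ← Real.log_le_iff_le_exp (hb k)]
    linarith [(abs_le.1 (hE k)).2]
  have hge : ∀ k, Real.exp (E k) ≤ Real.exp K * b k := fun k => by
    rw [← Real.exp_log (hb k), ← Real.exp_add, Real.exp_le_exp]
    linarith [(abs_le.1 (hE k)).1]
  have hSle : ∑ k, b k ≤ Real.exp K * ∑ k, Real.exp (E k) := by
    rw [Finset.mul_sum]; exact Finset.sum_le_sum fun k _ => hle k
  have hSge : ∑ k, Real.exp (E k) ≤ Real.exp K * ∑ k, b k := by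
    rw [Finset.mul_sum]; exact Finset.sum_le_sum fun k _ => hge k
  have h2 : Real.exp (2 * K) = Real.exp K * Real.exp K := by rw [← Real.exp_add]; congr 1; ring
  have hK := Real.exp_pos K
  rw [expWeights, h2]
  constructor
  · rw [inv_mul_le_iff₀ (by positivity), div_le_iff₀ hSE]
    calc Real.exp (E m) ≤ Real.exp K * b m := hge m
      _ = Real.exp K * (b m / ∑ k, b k) * ∑ k, b k := by field_simp
      _ ≤ Real.exp K * (b m / ∑ k, b k) * (Real.exp K * ∑ k, Real.exp (E k)) := by
          have := (div_pos (hb m) hS).le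
          gcongr
      _ = _ := by ring
  · rw [div_le_iff₀ hS]
    calc b m ≤ Real.exp K * Real.exp (E m) := hle m
      _ = Real.exp K * (Real.exp (E m) / ∑ k, Real.exp (E k)) * ∑ k, Real.exp (E k) := by
          field_simp
      _ ≤ Real.exp K * (Real.exp (E m) / ∑ k, Real.exp (E k))
            * (Real.exp K * ∑ k, b k) := by gcongr
      _ = _ := by ring

/-- Probability vectors whose entries other than the one of index `m₀` vanish in the limit converge
to the unit mass at `m₀`. -/
lemma tendsto_unit_mass [DecidableEq ι] {w : ℕ → ι → ℝ} {m₀ : ι}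
    (hsum : ∀ᶠ N in atTop, ∑ k, w N k = 1)
    (h0 : ∀ k, k ≠ m₀ → Tendsto (fun N => w N k) atTop (𝓝 0)) (m : ι) :
    Tendsto (fun N => w N m) atTop (𝓝 (if m = m₀ then 1 else 0)) := by
  split_ifs with h
  · subst h
    have h1 : Tendsto (fun N => 1 - ∑ k ∈ Finset.univ.erase m, w N k) atTop
        (𝓝 (1 - ∑ k ∈ Finset.univ.erase m, (0 : ℝ))) :=
      (tendsto_finsetSum _ fun k hk => h0 k (Finset.ne_of_mem_erase hk)).const_sub 1
    rw [Finset.sum_const_zero, sub_zero] at h1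
    refine h1.congr' ?_
    filter_upwards [hsum] with N hN
    rw [← hN, ← Finset.add_sum_erase _ _ (Finset.mem_univ m)]
    ring
  · exact h0 m h

lemma tendsto_expWeights [DecidableEq ι] {E : ℕ → ι → ℝ} {m₀ : ι}
    (hE : ∀ k, k ≠ m₀ → Tendsto (fun N => E N m₀ - E N k) atTop atTop) (m : ι) :
    Tendsto (fun N => expWeights (E N) m) atTop (𝓝 (if m = m₀ then 1 else 0)) := by
  have : Nonempty ι := ⟨m⟩
  refine tendsto_unit_mass (Eventually.of_forall fun N => sum_expWeights (E N)) (fun k hk => ?_) m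
  exact squeeze_zero (fun N => expWeights_nonneg _ _) (fun N => expWeights_le_exp_sub (E N) m₀ k)
    (Real.tendsto_exp_neg_atTop_nhds_zero.comp (hE k hk))

end Posterior

/-! ### The law of the observations -/

section Law

variable {p q : ℕ} {S : Set (RVec p × RVec q)} {f : RVec p × RVec q → ℝ}

/-- The density of `X` is positive at almost every observation. -/
lemma ae_marginalDensity_ne_zero (hS : IsCompact S) (hf : ContinuousOn f S)
    (hf0 : ∀ z ∈ S, 0 ≤ f z) :
    ∀ᵐ z ∂((volume.restrict S).withDensity fun z => ENNReal.ofReal (f z)),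
      marginalDensity S f z.1 ≠ 0 := by
  have hSm := hS.measurableSet
  set g : RVec p × RVec q → ℝ := S.indicator f with hg
  have hg0 : ∀ z, 0 ≤ g z := Set.indicator_nonneg hf0
  have hgm : Measurable g := by
    classical
    rw [hg, ← Set.piecewise_eq_indicator]
    exact hf.measurable_piecewise continuousOn_const hSm
  have hgi : Integrable g ((volume : Measure (RVec p)).prod (volume : Measure (RVec q))) :=
    (integrable_indicator_iff hSm).2 (hf.integrableOn_compact hS)
  have hmarg : Measurable (marginalDensity S f) :=
    (hgm.stronglyMeasurable.integral_prod_right' (ν := (volume : Measure (RVec q)))).measurable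
  set A : Set (RVec p) := {x | marginalDensity S f x = 0} with hA
  have hAm : MeasurableSet A := hmarg (measurableSet_singleton 0)
  have hμ : (volume.restrict S).withDensity (fun z => ENNReal.ofReal (f z))
      = (volume : Measure (RVec p × RVec q)).withDensity fun z => ENNReal.ofReal (g z) := by
    rw [← withDensity_indicator hSm]
    congr 1
    ext1 z
    by_cases hz : z ∈ S <;> simp [hg, hz]
  rw [hμ, ae_iff]
  simp only [ne_eq, not_not]
  have hset : {z : RVec p × RVec q | marginalDensity S f z.1 = 0} = A ×ˢ Set.univ := by
    ext z; simp [hA]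
  rw [hset, withDensity_apply _ (hAm.prod MeasurableSet.univ), Measure.volume_eq_prod,
    ← Measure.prod_restrict, lintegral_prod _ hgm.ennreal_ofReal.aemeasurable,
    Measure.restrict_univ]
  refine (lintegral_eq_zero_iff' ?_).2 ?_
  · exact (hgm.ennreal_ofReal.lintegral_prod_right').aemeasurable
  · filter_upwards [ae_restrict_mem hAm, ae_restrict_of_ae hgi.prod_right_ae] with x hx hix
    rw [← ofReal_integral_eq_lintegral_ofReal hix (Eventually.of_forall fun y => hg0 _)]
    have hx0 : ∫ y, g (x, y) = 0 := hx
    simp [hx0]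

lemma absolutelyContinuous_restrict_of_subset {μ : Measure (RVec p × RVec q)}
    (hμ : μ ≪ volume.restrict S) {S' : Set (RVec p × RVec q)} (h : S ⊆ S') :
    μ ≪ volume.restrict S' :=
  hμ.trans (Measure.restrict_mono h le_rfl).absolutelyContinuous

lemma map_fst_absolutelyContinuous {μ : Measure (RVec p × RVec q)}
    (hμ : μ ≪ volume.restrict S) {S' : Set (RVec p)}
    (h : Prod.fst '' S ⊆ S') :
    μ.map Prod.fst ≪ volume.restrict S' := by
  refine Measure.AbsolutelyContinuous.mk fun A hA h0 => ?_
  rw [Measure.map_apply measurable_fst hA]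
  refine hμ ?_
  rw [Measure.restrict_apply (measurable_fst hA)]
  rw [Measure.restrict_apply hA] at h0
  refine measure_mono_null (t := Prod.fst ⁻¹' (A ∩ S')) ?_
    (Measure.quasiMeasurePreserving_fst.preimage_null h0)
  rintro z ⟨hz, hzS⟩
  exact ⟨hz, h ⟨z, hzS, rfl⟩⟩

end Law

/-! ### The comparison of the models -/

section Comparison

variable {p q M : ℕ} {𝓜 : Models p q M} {z : ℕ → RVec p × RVec q} {N : ℕ} {Kj Km : ℝ}
  {Kc : Fin M → ℝ}

lemma condLikelihood_pos
    (hj : EvidenceApprox 𝓜.joint.density Set.univ 𝓜.joint.prior Kj z N)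
    (hm : EvidenceApprox 𝓜.marg.density Set.univ 𝓜.marg.prior Km (fun n => (z n).1) N)
    (hc : ∀ m, EvidenceApprox (𝓜.comp m).density (𝓜.comp m).Θ (𝓜.comp m).prior (Kc m) z N)
    (k : Fin (M + 1)) : 0 < 𝓜.condLikelihood z N k := by
  induction k using Fin.cases with
  | zero => exact div_pos hj.2.1 hm.2.1
  | succ i => exact (hc i).2.1

lemma abs_log_condLikelihood_sub_evidence_le
    (hj : EvidenceApprox 𝓜.joint.density Set.univ 𝓜.joint.prior Kj z N)
    (hm : EvidenceApprox 𝓜.marg.density Set.univ 𝓜.marg.prior Km (fun n => (z n).1) N)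
    (hc : ∀ m, EvidenceApprox (𝓜.comp m).density (𝓜.comp m).Θ (𝓜.comp m).prior (Kc m) z N)
    {t : 𝓜.Params} (ht : t.IsMLE z N) (k : Fin (M + 1)) :
    |Real.log (𝓜.condLikelihood z N k) - t.evidence z N k| ≤ |Kj| + |Km| + ∑ m, |Kc m| := by
  have hsum : 0 ≤ ∑ m, |Kc m| := Finset.sum_nonneg fun _ _ => abs_nonneg _
  induction k using Fin.cases with
  | zero =>
    have h1 := abs_le.1 ((hj.2.2 _ ht.joint).trans (le_abs_self Kj))
    have h2 := abs_le.1 ((hm.2.2 _ ht.marg).trans (le_abs_self Km))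
    simp only [Models.condLikelihood, Models.Params.evidence, Fin.cons_zero]
    rw [Real.log_div hj.2.1.ne' hm.2.1.ne', abs_le]
    constructor <;> linarith
  | succ i =>
    have h1 := (hc i).2.2 _ (ht.comp i)
    have h2 := Finset.single_le_sum (f := fun m => |Kc m|) (fun _ _ => abs_nonneg _)
      (Finset.mem_univ i)
    simp only [Models.condLikelihood, Models.Params.evidence, Fin.cons_succ]
    refine h1.trans ?_
    have := le_abs_self (Kc i)
    have := abs_nonneg Kj
    have := abs_nonneg Km
    linarith

end Comparison

end OptInfo

end

theorem mainTheorem6 {Ω : Type*} [MeasurableSpace Ω] (P : Measure Ω) [IsProbabilityMeasure P]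
    {p q M : ℕ}
    -- the true density `f` of `(X, Y)` on the compact set `S`
    (S : Set (OptInfo.RVec p × OptInfo.RVec q)) (hS : IsCompact S)
    (f : OptInfo.RVec p × OptInfo.RVec q → ℝ) (hf : ContinuousOn f S) (hf0 : ∀ z ∈ S, 0 ≤ f z)
    (μ : Measure (OptInfo.RVec p × OptInfo.RVec q))
    (hμ : μ = (volume.restrict S).withDensity fun z => ENNReal.ofReal (f z))
    -- the independent, identically distributed observations
    (Z : ℕ → Ω → OptInfo.RVec p × OptInfo.RVec q) (hZ : ∀ n, Measurable (Z n))
    (hZind : iIndepFun Z P) (hZlaw : ∀ n, P.map (Z n) = μ)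
    -- the models
    (𝓜 : OptInfo.Models p q M)
    (hjointS : S ⊆ 𝓜.joint.S) (hmargS : Prod.fst '' S ⊆ 𝓜.marg.S)
    (hjoint : 𝓜.joint.IsRegular μ) (hmarg : 𝓜.marg.IsRegular (μ.map Prod.fst))
    (hcomp : ∀ m, (𝓜.comp m).IsRegular S μ) :
    ∃ C : ℝ, 0 < C ∧ ∀ᵐ ω ∂P,
      -- the likelihood of the `x`-data cancels
      (∀ (N : ℕ) (m : Fin (M + 1)),
        𝓜.posteriorProb (OptInfo.marginalDensity S f) (fun n => Z n ω) N m =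
          𝓜.condLikelihood (fun n => Z n ω) N m /
            ∑ k, 𝓜.condLikelihood (fun n => Z n ω) N k) ∧
      (∀ᶠ N : ℕ in atTop,
        -- the maximum likelihood estimates exist
        (∃ t : 𝓜.Params, t.IsMLE (fun n => Z n ω) N) ∧
        ∀ t : 𝓜.Params, t.IsMLE (fun n => Z n ω) N →
          -- model `0` is the one that generates the optimum information estimators
          OptInfo.IsOIE 𝓜.joint.S 𝓜.joint.T
            (OptInfo.sampleMoment 𝓜.joint.T (fun n => Z n ω) N)
            (fun z => 𝓜.joint.density z t.joint) ∧
          OptInfo.IsOIE 𝓜.marg.S 𝓜.marg.T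
            (OptInfo.sampleMoment 𝓜.marg.T (fun n => (Z n ω).1) N)
            (fun x => 𝓜.marg.density x t.marg) ∧
          ∀ m : Fin (M + 1),
            -- the evidence approximates the log Bayesian likelihood with bounded error
            |Real.log (𝓜.condLikelihood (fun n => Z n ω) N m) - t.evidence (fun n => Z n ω) N m|
              ≤ C ∧
            -- the posterior model probabilities
            C⁻¹ * OptInfo.expWeights (t.evidence (fun n => Z n ω) N) m ≤
              𝓜.posteriorProb (OptInfo.marginalDensity S f) (fun n => Z n ω) N m ∧
            𝓜.posteriorProb (OptInfo.marginalDensity S f) (fun n => Z n ω) N m ≤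
              C * OptInfo.expWeights (t.evidence (fun n => Z n ω) N) m) ∧
      -- if the evidence singles out one model, the formula with the exponents `N * E_m` and the
      -- one with the exponents `E_m` both give the posterior up to a vanishing error
      (∀ t : ℕ → 𝓜.Params, (∀ᶠ N in atTop, (t N).IsMLE (fun n => Z n ω) N) →
        ∀ m₀ : Fin (M + 1),
          (∀ k, k ≠ m₀ → Tendsto (fun N => (t N).evidence (fun n => Z n ω) N m₀
            - (t N).evidence (fun n => Z n ω) N k) atTop atTop) →
          ∀ m : Fin (M + 1),
            Tendsto (fun N => 𝓜.posteriorProb (OptInfo.marginalDensity S f) (fun n => Z n ω) N m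
              - OptInfo.expWeights ((t N).evidence (fun n => Z n ω) N) m) atTop (𝓝 0) ∧
            Tendsto (fun N : ℕ =>
              𝓜.posteriorProb (OptInfo.marginalDensity S f) (fun n => Z n ω) N m
              - OptInfo.expWeights (fun k => (N : ℝ) * (t N).evidence (fun n => Z n ω) N k) m)
              atTop (𝓝 0)) := by
  classical
  have hμprob : IsProbabilityMeasure μ := by
    rw [← hZlaw 0]; exact Measure.isProbabilityMeasure_map (hZ 0).aemeasurable
  have hSm := hS.measurableSet
  have hμac : μ ≪ volume.restrict S := hμ ▸ withDensity_absolutelyContinuous _ _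
  have hμS : ∀ᵐ z ∂μ, z ∈ S := hμac.ae_le (ae_restrict_mem hSm)
  have hind : Pairwise fun i j => IndepFun (Z i) (Z j) P := fun i j hij => hZind.indepFun hij
  have hind1 : Pairwise fun i j => IndepFun (fun ω => (Z i ω).1) (fun ω => (Z j ω).1) P :=
    fun i j hij => (hind hij).comp measurable_fst measurable_fst
  have hlaw1 : ∀ n, P.map (fun ω => (Z n ω).1) = μ.map Prod.fst := fun n => by
    rw [← hZlaw n, Measure.map_map measurable_fst (hZ n)]; rfl
  have hμ1prob : IsProbabilityMeasure (μ.map Prod.fst) :=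
    Measure.isProbabilityMeasure_map measurable_fst.aemeasurable
  obtain ⟨Kj, hKj⟩ := hjoint.exists_evidenceApprox
    (OptInfo.absolutelyContinuous_restrict_of_subset hμac hjointS) hZ hind hZlaw
  obtain ⟨Km, hKm⟩ := hmarg.exists_evidenceApprox
    (OptInfo.map_fst_absolutelyContinuous hμac hmargS)
    (fun n => measurable_fst.comp (hZ n)) hind1 hlaw1
  choose Kc hKc using fun m => (hcomp m).exists_evidenceApprox hS hμS hZ hind hZlaw
  set K : ℝ := |Kj| + |Km| + ∑ m, |Kc m| with hK
  have hK0 : 0 ≤ K := by positivity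
  have hfX : ∀ᵐ ω ∂P, ∀ n, OptInfo.marginalDensity S f (Z n ω).1 ≠ 0 := by
    rw [ae_all_iff]
    intro n
    refine ae_of_ae_map (hZ n).aemeasurable
      (p := fun z => OptInfo.marginalDensity S f z.1 ≠ 0) ?_
    rw [hZlaw n, hμ]
    exact OptInfo.ae_marginalDensity_ne_zero hS hf hf0
  refine ⟨Real.exp (2 * K), Real.exp_pos _, ?_⟩
  filter_upwards [hfX, hKj, hKm, ae_all_iff.2 hKc] with ω hω hj hm hc
  have hcancel : ∀ (N : ℕ) (m : Fin (M + 1)),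
      𝓜.posteriorProb (OptInfo.marginalDensity S f) (fun n => Z n ω) N m =
        𝓜.condLikelihood (fun n => Z n ω) N m /
          ∑ k, 𝓜.condLikelihood (fun n => Z n ω) N k := fun N m =>
    OptInfo.posterior_const_mul (by positivity) (Finset.prod_ne_zero_iff.2 fun n _ => hω n) _ m
  have hall := hj.and (hm.and (eventually_all.2 hc))
  have hbounds : ∀ᶠ N : ℕ in atTop, ∀ t : 𝓜.Params, t.IsMLE (fun n => Z n ω) N →
      ∀ m : Fin (M + 1),
        (Real.exp (2 * K))⁻¹ * OptInfo.expWeights (t.evidence (fun n => Z n ω) N) m ≤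
          𝓜.posteriorProb (OptInfo.marginalDensity S f) (fun n => Z n ω) N m ∧
        𝓜.posteriorProb (OptInfo.marginalDensity S f) (fun n => Z n ω) N m ≤
          Real.exp (2 * K) * OptInfo.expWeights (t.evidence (fun n => Z n ω) N) m := by
    filter_upwards [hall] with N hN t ht m
    rw [hcancel]
    exact OptInfo.expWeights_bounds (OptInfo.condLikelihood_pos hN.1.1 hN.2.1.1 hN.2.2)
      (OptInfo.abs_log_condLikelihood_sub_evidence_le hN.1.1 hN.2.1.1 hN.2.2 ht) m
  refine ⟨hcancel, ?_, ?_⟩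
  · filter_upwards [hall, hbounds] with N hN hb
    obtain ⟨tj, htj⟩ := hN.1.1.1
    obtain ⟨tm, htm⟩ := hN.2.1.1.1
    choose tc htc using fun m => (hN.2.2 m).1
    refine ⟨⟨⟨tj, tm, tc⟩, htj, htm, htc⟩, fun t ht => ⟨hN.1.2 _ ht.joint, hN.2.1.2 _ ht.marg,
      fun m => ⟨?_, hb t ht m⟩⟩⟩
    refine (OptInfo.abs_log_condLikelihood_sub_evidence_le hN.1.1 hN.2.1.1 hN.2.2 ht m).trans ?_
    linarith [Real.add_one_le_exp (2 * K)]
  · intro t ht m₀ hm₀ m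
    have hE := OptInfo.tendsto_expWeights hm₀
    have hNE := OptInfo.tendsto_expWeights
      (E := fun N k => (N : ℝ) * (t N).evidence (fun n => Z n ω) N k) (m₀ := m₀) fun k hk => by
        simp only [← mul_sub]
        exact tendsto_natCast_atTop_atTop.atTop_mul_atTop₀ (hm₀ k hk)
    have hP : Tendsto (fun N => 𝓜.posteriorProb (OptInfo.marginalDensity S f)
        (fun n => Z n ω) N m) atTop (𝓝 (if m = m₀ then 1 else 0)) := by
      refine OptInfo.tendsto_unit_mass (w := fun N => 𝓜.posteriorProb
        (OptInfo.marginalDensity S f) (fun n => Z n ω) N) ?_ (fun k hk => ?_) m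
      · filter_upwards [hall] with N hN
        simp only [hcancel]
        rw [← Finset.sum_div, div_self]
        exact (Finset.sum_pos (fun k _ => OptInfo.condLikelihood_pos hN.1.1 hN.2.1.1 hN.2.2 k)
          Finset.univ_nonempty).ne'
      · have h0 := hE k
        rw [if_neg hk] at h0
        have h1 := h0.const_mul (Real.exp (2 * K))
        have h2 := h0.const_mul (Real.exp (2 * K))⁻¹
        rw [mul_zero] at h1 h2
        refine tendsto_of_tendsto_of_tendsto_of_le_of_le' h2 h1 ?_ ?_
        · filter_upwards [ht, hbounds] with N hN hb using (hb _ hN k).1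
        · filter_upwards [ht, hbounds] with N hN hb using (hb _ hN k).2
    exact ⟨by simpa using hP.sub (hE m), by simpa using hP.sub (hNE m)⟩
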